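/- Let $K\subset\mathbb{R}^3$ be a strictly convex body (compact, strictly convex, with non-empty interior) that is centrally symmetric with centre $o$. Let $L$ be a line with $o\notin L$, let $\Omega$ be the plane containing $o$ and $L$, and let $p\in\Omega\setminus L$ be an interior point of $K$ such that, if $p\neq o$, the line $op$ is not perpendicular to $L$. Suppose that $p$ is a Larman point of $K$, i.e. for every plane $\Pi$ through $p$ the section $\Pi\cap K$ has a line of symmetry (a line $M\subset\Pi$ such that the reflection of $\Pi$ across $M$ maps $\Pi\cap K$ onto itself). Suppose moreover that for every plane $\Pi$ through $p$ the section $\Pi\cap K$ has a line of symmetry $M$ that intersects $L$ or, when $\Pi$ is parallel to $L$, is parallel to $L$. (So $M$ intersects $L$ if $\Pi\cap L$ is a single point, and $M$ is parallel to $L$ if $\Pi\cap L=\emptyset$; for $\Pi=\Omega\supset L$ either is allowed.) Then: (i) if $p=o$, then $K$ is a body of revolution, i.e. there is a line $A$ such that every isometry of $\mathbb{R}^3$ fixing $A$ pointwise maps $K$ onto itself; (ii) if $p\neq o$, then $K$ is a Euclidean ball (with centre $o$ and positive radius). -/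

import Mathlib

open scoped EuclideanGeometry

/-- Euclidean three-dimensional space. -/
abbrev E3 : Type := EuclideanSpace ℝ (Fin 3)

/-- An affine subspace of `ℝ³` is a (one-dimensional) line. -/
def IsLine (M : AffineSubspace ℝ E3) : Prop :=
  (M : Set E3).Nonempty ∧ Module.finrank ℝ M.direction = 1

/-- An affine subspace of `ℝ³` is a (two-dimensional) plane. -/
def IsPlane (P : AffineSubspace ℝ E3) : Prop :=
  (P : Set E3).Nonempty ∧ Module.finrank ℝ P.direction = 2

/-- `S` is centrally symmetric with centre `o`. -/
def IsCentrallySymmetric (S : Set E3) (o : E3) : Prop :=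
  Equiv.pointReflection o '' S = S

/-- `M` is a line of symmetry of the section `P ∩ K`: a line contained in the plane `P` such that
the reflection in `M` maps `P ∩ K` onto itself. (The map `EuclideanGeometry.reflection M` of `ℝ³`
fixes `M` pointwise and reverses the vectors orthogonal to `M`, so on a plane containing `M` it is
the usual reflection of that plane across the line `M`.) -/
def IsLineOfSymmetry (M P : AffineSubspace ℝ E3) (K : Set E3) : Prop :=
  IsLine M ∧ M ≤ P ∧
    ∃ _ : Nonempty M, EuclideanGeometry.reflection M '' ((P : Set E3) ∩ K) = (P : Set E3) ∩ K

/-- `p` is a Larman point of `K ⊆ ℝ³`: every section of `K` by a plane through `p` has a line of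
symmetry. -/
def IsLarmanPoint (K : Set E3) (p : E3) : Prop :=
  ∀ P : AffineSubspace ℝ E3, IsPlane P → p ∈ P → ∃ M, IsLineOfSymmetry M P K

/-- `K` is a body of revolution: there is a line `A` such that every isometry of `ℝ³` fixing `A`
pointwise maps `K` onto itself. -/
def IsBodyOfRevolution (K : Set E3) : Prop :=
  ∃ A : AffineSubspace ℝ E3, IsLine A ∧
    ∀ g : E3 ≃ᵃⁱ[ℝ] E3, (∀ x ∈ A, g x = x) → g '' K = K

open Filter Topology

theorem E3.inner_eq (x y : E3) : inner ℝ x y = x 0 * y 0 + x 1 * y 1 + x 2 * y 2 := by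
  simp [PiLp.inner_apply, Fin.sum_univ_three]; ring

theorem E3.norm_sq_eq (x : E3) : ‖x‖ ^ 2 = x 0 ^ 2 + x 1 ^ 2 + x 2 ^ 2 := by
  rw [← real_inner_self_eq_norm_sq, E3.inner_eq]; ring

theorem E3.norm_eq_one_iff (x : E3) : ‖x‖ = 1 ↔ x 0 ^ 2 + x 1 ^ 2 + x 2 ^ 2 = 1 := by
  rw [← E3.norm_sq_eq, pow_eq_one_iff_of_nonneg (norm_nonneg x) two_ne_zero]

theorem E3.ext {x y : E3} (h0 : x 0 = y 0) (h1 : x 1 = y 1) (h2 : x 2 = y 2) : x = y := by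
  ext i; fin_cases i <;> assumption

/-- An odd norm-preserving map followed by a translation can preserve a nonempty compact centrally
symmetric set only if the translation is trivial. -/
theorem eq_zero_of_add_mem {V : Type*} [NormedAddCommGroup V] [InnerProductSpace ℝ V] {S : Set V}
    (hS : IsCompact S) (hne : S.Nonempty) (hneg : ∀ x ∈ S, -x ∈ S) {c : V} {A : V → V}
    (hodd : ∀ x, A (-x) = -A x) (hA : ∀ x ∈ S, ‖A x‖ = ‖x‖) (h : ∀ x ∈ S, c + A x ∈ S) : c = 0 := by
  obtain ⟨x, hx, hmax⟩ := hS.exists_isMaxOn hne continuous_norm.continuousOn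
  have h1 : ‖c + A x‖ ≤ ‖x‖ := hmax (h x hx)
  have h2 : ‖c - A x‖ ≤ ‖x‖ := by
    have := hmax (h (-x) (hneg x hx))
    simpa [hodd, sub_eq_add_neg] using this
  have h3 := parallelogram_law_with_norm ℝ c (A x)
  rw [hA x hx] at h3
  have : ‖c‖ = 0 := by
    nlinarith [norm_nonneg (c + A x), norm_nonneg (c - A x), norm_nonneg x, norm_nonneg c]
  simpa using this

theorem eq_zero_of_translate_mem {V : Type*} [NormedAddCommGroup V] [InnerProductSpace ℝ V]
    {S : Set V} (hS : IsCompact S) (hne : S.Nonempty) {c : V} (h : ∀ x ∈ S, x + c ∈ S) :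
    c = 0 := by
  obtain ⟨x, hx, hmax⟩ := hS.exists_isMaxOn hne
    (f := fun y => inner ℝ c y) (by fun_prop)
  have := hmax (h x hx)
  simp only [Set.mem_ofPred_eq, inner_add_right, real_inner_self_eq_norm_sq] at this
  have : ‖c‖ = 0 := by nlinarith [norm_nonneg c]
  simpa using this

/-- The half-turn of space about the line through `m` with unit direction vector `u`. -/
noncomputable def halfTurn (m u x : E3) : E3 := (2 : ℝ) • (m + inner ℝ (x - m) u • u) - x

theorem halfTurn_apply (m u x : E3) (i : Fin 3) :
    halfTurn m u x i = 2 * (m i + inner ℝ (x - m) u * u i) - x i := by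
  simp only [halfTurn, PiLp.sub_apply, PiLp.smul_apply, PiLp.add_apply, smul_eq_mul]

theorem halfTurn_zero (u x : E3) : halfTurn 0 u x = (2 * inner ℝ x u) • u - x := by
  simp [halfTurn, mul_smul]

theorem continuous_halfTurn (m u : E3) : Continuous (halfTurn m u) := by
  unfold halfTurn; fun_prop

theorem halfTurn_neg (m u : E3) : halfTurn m (-u) = halfTurn m u := by
  ext x; simp [halfTurn]

theorem norm_halfTurn_zero {u : E3} (hu : ‖u‖ = 1) (x : E3) : ‖halfTurn 0 u x‖ = ‖x‖ := by
  rw [← sq_eq_sq₀ (norm_nonneg _) (norm_nonneg _), halfTurn_zero, norm_sub_sq_real, norm_smul, hu,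
    real_inner_smul_left, real_inner_comm x u, Real.norm_eq_abs, mul_one, sq_abs]
  ring

theorem halfTurn_eq_add (m u x : E3) :
    halfTurn m u x = (2 : ℝ) • (m - inner ℝ m u • u) + halfTurn 0 u x := by
  simp only [halfTurn, inner_sub_left, sub_zero, zero_add]
  module

theorem inner_halfTurn_sub {p m u w x : E3} (hu : inner ℝ u w = 0) (hm : inner ℝ (m - p) w = 0)
    (hx : inner ℝ (x - p) w = 0) : inner ℝ (halfTurn m u x - p) w = 0 := by
  simp only [halfTurn, inner_sub_left, inner_add_left, real_inner_smul_left] at *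
  linear_combination 2 * hm - hx + 2 * (inner ℝ x u - inner ℝ m u) * hu

/-- The line through `m` with unit direction vector `u` is a line of symmetry of the section of `K`
by the plane through `p` with normal vector `w`. -/
structure SectionAxis (K : Set E3) (p w m u : E3) : Prop where
  unit : ‖u‖ = 1
  orth : inner ℝ u w = 0
  mem : inner ℝ (m - p) w = 0
  maps : ∀ x ∈ K, inner ℝ (x - p) w = 0 → halfTurn m u x ∈ K

/-- A convex set with interior points lies in any closed set that contains its points off
two given hyperplanes. -/
theorem Convex.subset_of_generic_subset {C F : Set E3} (hC : Convex ℝ C) (hF : IsClosed F)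
    (hne : (interior C).Nonempty) (h : ∀ x ∈ C, x 1 ≠ 0 → x 2 ≠ 0 → x ∈ F) : C ⊆ F := by
  have hd : ∀ i : Fin 3, Dense {x : E3 | x i ≠ 0} := by
    intro i x
    have ht : Tendsto (fun t : ℝ => x + t • EuclideanSpace.single i (1 : ℝ)) (𝓝[≠] 0) (𝓝 x) := by
      have : Tendsto (fun t : ℝ => x + t • EuclideanSpace.single i (1 : ℝ)) (𝓝 0)
          (𝓝 (x + (0 : ℝ) • EuclideanSpace.single i (1 : ℝ))) :=
        (by fun_prop : Continuous fun t : ℝ => x + t • EuclideanSpace.single i (1 : ℝ)).tendsto 0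
      rw [zero_smul, add_zero] at this
      exact this.mono_left nhdsWithin_le_nhds
    by_cases hx : x i = 0
    · refine mem_closure_of_tendsto ht ?_
      filter_upwards [self_mem_nhdsWithin] with t ht'
      simpa [hx] using ht'
    · exact subset_closure hx
  have ho : ∀ i : Fin 3, IsOpen {x : E3 | x i ≠ 0} := fun i =>
    isOpen_ne_fun (by fun_prop) continuous_const
  have hd12 : Dense ({x : E3 | x 1 ≠ 0} ∩ {x : E3 | x 2 ≠ 0}) :=
    (hd 1).inter_of_isOpen_left (hd 2) (ho 1)
  have h1 : interior C ⊆ F := by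
    refine (hd12.open_subset_closure_inter isOpen_interior).trans ?_
    refine closure_minimal ?_ hF
    rintro x ⟨hx, hx1, hx2⟩
    exact h x (interior_subset hx) hx1 hx2
  calc C ⊆ closure C := subset_closure
    _ = closure (interior C) := (hC.closure_interior_eq_closure_of_nonempty_interior hne).symm
    _ ⊆ F := closure_minimal h1 hF

/-- The line through `m` with direction vector `u` is coplanar with the line
`{z = 0, α x + β y = γ}`. -/
def CoplanarWith (α β γ : ℝ) (m u : E3) : Prop :=
  u 2 * (α * m 0 + β * m 1 - γ) = m 2 * (α * u 0 + β * u 1)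

/-- Every section of `K` by a plane through `p` has a line of symmetry that is coplanar with the
line `{z = 0, α x + β y = γ}`. -/
def HasCoplanarAxes (K : Set E3) (p : E3) (α β γ : ℝ) : Prop :=
  ∀ w : E3, w ≠ 0 → ∃ m u : E3, SectionAxis K p w m u ∧ CoplanarWith α β γ m u

theorem SectionAxis.eq_smul {K : Set E3} {p w m u : E3} (h : SectionAxis K p w m u)
    (hK : IsCompact K) (h0 : 0 ∈ K) (hneg : ∀ x ∈ K, -x ∈ K) (hp : inner ℝ p w = 0) :
    m = inner ℝ m u • u := by
  have hS : IsCompact (K ∩ {x | inner ℝ x w = 0}) :=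
    hK.inter_right (isClosed_eq (by fun_prop) continuous_const)
  have := eq_zero_of_add_mem hS ⟨0, h0, by simp⟩
    (fun x hx => ⟨hneg x hx.1, by simpa using hx.2⟩)
    (c := (2 : ℝ) • (m - inner ℝ m u • u)) (A := halfTurn 0 u)
    (fun x => by simp [halfTurn_zero]; module) (fun x _ => norm_halfTurn_zero h.unit x) (by
      rintro x ⟨hx, hxw⟩
      have hxw : inner ℝ x w = 0 := hxw
      have hx' : inner ℝ (x - p) w = 0 := by rw [inner_sub_left, hxw, hp, sub_zero]
      rw [← halfTurn_eq_add]
      refine ⟨h.maps x hx hx', ?_⟩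
      have := inner_halfTurn_sub h.orth h.mem hx'
      rw [inner_sub_left, hp, sub_zero] at this
      exact this)
  rw [smul_eq_zero_iff_right two_ne_zero, sub_eq_zero] at this
  exact this

theorem SectionAxis.direction_eq {K : Set E3} {p w m u : E3} (h : SectionAxis K p w m u)
    (hK : IsCompact K) (h0 : 0 ∈ K) (hneg : ∀ x ∈ K, -x ∈ K) (hp : inner ℝ p w = 0)
    {α β γ : ℝ} (hγ : γ ≠ 0) (hc : CoplanarWith α β γ m u) : u 2 = 0 := by
  have hm := h.eq_smul hK h0 hneg hp
  set c := inner ℝ m u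
  rw [CoplanarWith, hm] at hc
  simp only [PiLp.smul_apply, smul_eq_mul] at hc
  have : u 2 * γ = 0 := by linear_combination -hc
  simpa [hγ] using this

theorem eq_or_eq_neg_of_planar {u v w : E3} (hu : ‖u‖ = 1) (hv : ‖v‖ = 1) (hu2 : u 2 = 0)
    (hv2 : v 2 = 0) (huw : inner ℝ u w = 0) (hvw : inner ℝ v w = 0) (hw : w 0 ≠ 0 ∨ w 1 ≠ 0) :
    u = v ∨ u = -v := by
  rw [E3.norm_eq_one_iff] at hu hv
  rw [E3.inner_eq] at huw hvw
  rw [hu2] at hu huw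
  rw [hv2] at hv hvw
  have hd : u 0 * v 1 - u 1 * v 0 = 0 := by
    rcases hw with hw | hw <;> refine (mul_eq_zero_iff_right hw).1 ?_
    · linear_combination v 1 * huw - u 1 * hvw
    · linear_combination -v 0 * huw + u 0 * hvw
  have hsq : (u 0 * v 0 + u 1 * v 1) ^ 2 = 1 := by
    linear_combination (-(u 0 * v 1 - u 1 * v 0)) * hd + (v 0 ^ 2 + v 1 ^ 2) * hu + hv
  rcases sq_eq_one_iff.1 hsq with h | h
  · left
    refine E3.ext ?_ ?_ (by rw [hu2, hv2])
    · linear_combination v 0 * h - u 0 * hv + v 1 * hd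
    · linear_combination v 1 * h - u 1 * hv - v 0 * hd
  · right
    refine E3.ext ?_ ?_ (by simp [hu2, hv2])
    · simp; linear_combination v 0 * h - u 0 * hv + v 1 * hd
    · simp; linear_combination v 1 * h - u 1 * hv - v 0 * hd

theorem HasCoplanarAxes.halfTurn_mem {K : Set E3} {p : E3} {α β γ : ℝ}
    (hH : HasCoplanarAxes K p α β γ) (hK : IsCompact K) (hcv : Convex ℝ K)
    (hint : (interior K).Nonempty) (h0 : 0 ∈ K) (hneg : ∀ x ∈ K, -x ∈ K) (hγ : γ ≠ 0)
    {v : E3} (hv : ‖v‖ = 1) (hv2 : v 2 = 0) {c : ℝ} (hp : p = c • v) :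
    ∀ x ∈ K, halfTurn 0 v x ∈ K := by
  refine hcv.subset_of_generic_subset (F := halfTurn 0 v ⁻¹' K)
    (hK.isClosed.preimage (continuous_halfTurn 0 v)) hint fun x hx _ hx2 => ?_
  let w : E3 := !₂[v 1 * x 2, -(v 0 * x 2), v 0 * x 1 - v 1 * x 0]
  have hw0 : w 0 = v 1 * x 2 := rfl
  have hw1 : w 1 = -(v 0 * x 2) := rfl
  have hw2 : w 2 = v 0 * x 1 - v 1 * x 0 := rfl
  have hv' := (E3.norm_eq_one_iff v).1 hv
  have hw : w 0 ≠ 0 ∨ w 1 ≠ 0 := by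
    by_contra! h
    rw [hw0, hw1] at h
    simp only [mul_eq_zero, hx2, or_false, neg_eq_zero] at h
    simp [h.1, h.2, hv2] at hv'
  have hvw : inner ℝ v w = 0 := by rw [E3.inner_eq, hw0, hw1, hw2, hv2]; ring
  have hxw : inner ℝ x w = 0 := by rw [E3.inner_eq, hw0, hw1, hw2]; ring
  have hpw : inner ℝ p w = 0 := by rw [hp, real_inner_smul_left, hvw, mul_zero]
  obtain ⟨m, u, hax, hcop⟩ := hH w (by rintro h; simp [h] at hw)
  have hm := hax.eq_smul hK h0 hneg hpw
  have hu2 := hax.direction_eq hK h0 hneg hpw hγ hcop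
  have key : halfTurn m u = halfTurn 0 v := by
    funext y
    rw [halfTurn_eq_add, sub_eq_zero.2 hm, smul_zero, zero_add]
    rcases eq_or_eq_neg_of_planar hax.unit hv hu2 hv2 hax.orth hvw hw with h | h
    · rw [h]
    · rw [h, halfTurn_neg]
  have := hax.maps x hx (by rw [inner_sub_left, hxw, hpw, sub_zero])
  rwa [key] at this

theorem HasCoplanarAxes.mem_of_norm_eq {K : Set E3} {α β γ : ℝ}
    (hH : HasCoplanarAxes K 0 α β γ) (hK : IsCompact K) (hcv : Convex ℝ K)
    (hint : (interior K).Nonempty) (h0 : 0 ∈ K) (hneg : ∀ x ∈ K, -x ∈ K) (hγ : γ ≠ 0)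
    {x y : E3} (hx : x ∈ K) (hn : ‖y‖ = ‖x‖) (h2 : y 2 = x 2) : y ∈ K := by
  rcases eq_or_ne x y with rfl | hne
  · exact hx
  have hd : ‖x - y‖ ≠ 0 := by simpa [sub_eq_zero] using hne
  have := hneg _ (hH.halfTurn_mem hK hcv hint h0 hneg hγ (v := ‖x - y‖⁻¹ • (x - y))
    (by rw [norm_smul, norm_inv, norm_norm, inv_mul_cancel₀ hd]) (by simp [h2]) (c := 0)
    (by simp) x hx)
  convert this using 1
  have hi : 2 * inner ℝ x (x - y) = ‖x - y‖ ^ 2 := by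
    rw [norm_sub_sq_real, inner_sub_right, real_inner_self_eq_norm_sq, hn]; ring
  rw [halfTurn_zero, real_inner_smul_right, smul_smul]
  have : 2 * (‖x - y‖⁻¹ * inner ℝ x (x - y)) * ‖x - y‖⁻¹ = 1 := by
    field_simp; linarith
  rw [this]; module

/-- The half-turn about the first coordinate axis. -/
def E3.flip (x : E3) : E3 := !₂[x 0, -x 1, -x 2]

@[simp] theorem E3.flip_apply_zero (x : E3) : E3.flip x 0 = x 0 := rfl
@[simp] theorem E3.flip_apply_one (x : E3) : E3.flip x 1 = -x 1 := rfl
@[simp] theorem E3.flip_apply_two (x : E3) : E3.flip x 2 = -x 2 := rfl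

@[simp] theorem E3.flip_flip (x : E3) : E3.flip (E3.flip x) = x := by
  refine E3.ext ?_ ?_ ?_ <;> simp

theorem E3.flip_eq_halfTurn (x : E3) : E3.flip x = halfTurn 0 (EuclideanSpace.single 0 1) x := by
  refine E3.ext ?_ ?_ ?_ <;> simp [halfTurn_apply, E3.inner_eq]
  ring

theorem SectionAxis.flip {K : Set E3} {p w m u : E3} (h : SectionAxis K p (E3.flip w) m u)
    (hK : ∀ x ∈ K, E3.flip x ∈ K) (hp1 : p 1 = 0) (hp2 : p 2 = 0) :
    SectionAxis K p w (E3.flip m) (E3.flip u) where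
  unit := by
    have := h.unit
    rw [E3.norm_eq_one_iff] at *
    simpa using this
  orth := by
    have := h.orth
    rw [E3.inner_eq] at *
    simpa using this
  mem := by
    have := h.mem
    rw [E3.inner_eq] at *
    simpa [hp1, hp2] using this
  maps x hx hxw := by
    have := hK _ (h.maps _ (hK x hx) (by rw [E3.inner_eq] at *; simpa [hp1, hp2] using hxw))
    convert this using 1
    refine E3.ext ?_ ?_ ?_ <;> simp only [halfTurn_apply, E3.inner_eq, E3.flip_apply_zero,
      E3.flip_apply_one, E3.flip_apply_two, PiLp.sub_apply] <;> ring

theorem HasCoplanarAxes.flip {K : Set E3} {p : E3} {α β γ : ℝ} (hH : HasCoplanarAxes K p α β γ)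
    (hK : ∀ x ∈ K, E3.flip x ∈ K) (hp1 : p 1 = 0) (hp2 : p 2 = 0) :
    HasCoplanarAxes K p α (-β) γ := by
  intro w hw
  obtain ⟨m, u, hax, hc⟩ := hH (E3.flip w) (fun h => hw (by
    rw [← E3.flip_flip w, h]; refine E3.ext ?_ ?_ ?_ <;> simp))
  refine ⟨_, _, hax.flip hK hp1 hp2, ?_⟩
  simp only [CoplanarWith, E3.flip_apply_zero, E3.flip_apply_one, E3.flip_apply_two] at *
  linear_combination -hc

/-- The axis may be based at the foot of the perpendicular from `p`, which lies in `K`. -/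
theorem HasCoplanarAxes.exists_foot {K : Set E3} {p : E3} {α β γ : ℝ}
    (hH : HasCoplanarAxes K p α β γ) (hcv : Convex ℝ K) (hp : p ∈ K) {w : E3} (hw : w ≠ 0) :
    ∃ m ∈ K, ∃ u, SectionAxis K p w m u ∧ CoplanarWith α β γ m u ∧ inner ℝ (m - p) u = 0 := by
  obtain ⟨m, u, h, hc⟩ := hH w hw
  have huu : inner ℝ u u = 1 := by rw [real_inner_self_eq_norm_sq, h.unit, one_pow]
  set c := inner ℝ (p - m) u with hcdef
  have hT : ∀ x, halfTurn (m + c • u) u x = halfTurn m u x := fun x => by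
    simp only [halfTurn, inner_sub_left, inner_add_left, real_inner_smul_left, huu]
    module
  refine ⟨m + c • u, ?_, u, ⟨h.unit, h.orth, ?_, fun x hx hxw => ?_⟩, ?_, ?_⟩
  · have hm := hcv.midpoint_mem hp (h.maps p hp (by simp))
    convert hm using 1
    rw [midpoint_eq_smul_add, halfTurn, ← hcdef]
    simp only [invOf_eq_inv]
    module
  · rw [add_sub_right_comm, inner_add_left, h.mem, real_inner_smul_left, h.orth]; simp
  · rw [hT]; exact h.maps x hx hxw
  · simp only [CoplanarWith, PiLp.add_apply, PiLp.smul_apply, smul_eq_mul] at *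
    linear_combination hc
  · simp only [hcdef, inner_sub_left, inner_add_left, real_inner_smul_left, huu]; ring

/-- The line in the coordinate plane `{z = 0}` through `p` is a line of symmetry of the section of
`K` by the plane through `p` with normal vector `w`. -/
def HasTraceAxis (K : Set E3) (p w : E3) : Prop :=
  ∀ a : E3, ‖a‖ = 1 → a 2 = 0 → inner ℝ a w = 0 →
    ∀ x ∈ K, inner ℝ (x - p) w = 0 → halfTurn p a x ∈ K

theorem SectionAxis.neg_direction {K : Set E3} {p w m u : E3} (h : SectionAxis K p w m (-u)) :
    SectionAxis K p w m u where
  unit := by simpa using h.unit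
  orth := by simpa using h.orth
  mem := h.mem
  maps := by simpa only [halfTurn_neg] using h.maps

theorem SectionAxis.eq_of_foot {K : Set E3} {p w m m' u : E3} (h : SectionAxis K p w m u)
    (h' : SectionAxis K p w m' u) (hK : IsCompact K) (hp : p ∈ K)
    (hm : inner ℝ (m - p) u = 0) (hm' : inner ℝ (m' - p) u = 0) : m = m' := by
  have hS : IsCompact (K ∩ {x | inner ℝ (x - p) w = 0}) :=
    hK.inter_right (isClosed_eq (by fun_prop) continuous_const)
  have huu : inner ℝ u u = 1 := by rw [real_inner_self_eq_norm_sq, h.unit, one_pow]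
  have := eq_zero_of_translate_mem hS ⟨p, hp, by simp⟩ (c := (2 : ℝ) • (m' - m)) (by
    rintro x ⟨hx, hxw⟩
    have h1 := h.maps x hx hxw
    have h2 := inner_halfTurn_sub h.orth h.mem hxw
    have h3 := h'.maps _ h1 h2
    have h4 := inner_halfTurn_sub h'.orth h'.mem h2
    have : halfTurn m' u (halfTurn m u x) = x + (2 : ℝ) • (m' - m) := by
      rw [inner_sub_left, sub_eq_zero] at hm hm'
      simp only [halfTurn, inner_sub_left, inner_add_left, real_inner_smul_left, huu, hm, hm']
      module
    rw [this] at h3 h4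
    exact ⟨h3, h4⟩)
  rw [smul_eq_zero_iff_right two_ne_zero, sub_eq_zero] at this
  exact this.symm

theorem hasTraceAxis_of_parallel {K : Set E3} {p w m m' u u' : E3} {α β γ : ℝ}
    (hK : IsCompact K) (hp : p ∈ K) (hp1 : p 1 = 0) (hp2 : p 2 = 0) (hβ : β ≠ 0)
    (hpγ : α * p 0 ≠ γ) (hw : w 0 ≠ 0)
    (h : SectionAxis K p w m u) (hc : CoplanarWith α β γ m u) (hm : inner ℝ (m - p) u = 0)
    (h' : SectionAxis K p w m' u') (hc' : CoplanarWith α (-β) γ m' u')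
    (hm' : inner ℝ (m' - p) u' = 0) (hu : u' = u ∨ u' = -u) : HasTraceAxis K p w := by
  wlog hu' : u' = u generalizing u'
  · have hu'' : u' = -u := hu.resolve_left hu'
    subst hu''
    refine this h'.neg_direction ?_ (by simpa using hm') (Or.inl rfl) rfl
    simp only [CoplanarWith, PiLp.neg_apply] at *
    linear_combination -hc'
  subst hu'
  obtain rfl := h.eq_of_foot h' hK hp hm hm'
  have hmw := h.mem
  have huw := h.orth
  have hun := (E3.norm_eq_one_iff _).1 h.unit
  simp only [CoplanarWith, E3.inner_eq, PiLp.sub_apply, hp1, hp2] at hc hc' hmw huw hm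
  have e1 : u' 2 * (α * m 0 - γ) = m 2 * (α * u' 0) := by linear_combination (hc + hc') / 2
  have e2 : u' 2 * m 1 = m 2 * u' 1 := by
    refine mul_left_cancel₀ hβ ?_
    linear_combination (hc - hc') / 2
  have hu2 : u' 2 = 0 := by
    by_contra hne
    have e3 : u' 2 * ((m 0 - p 0) * w 0) = m 2 * (u' 0 * w 0) := by
      linear_combination u' 2 * hmw - m 2 * huw - w 1 * e2
    have e4 : u' 2 * (m 0 - p 0) = m 2 * u' 0 := by
      refine mul_right_cancel₀ hw ?_
      linear_combination e3
    have e5 : u' 2 * (α * p 0 - γ) = 0 := by linear_combination e1 - α * e4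
    rcases mul_eq_zero.1 e5 with h | h
    · exact hne h
    · exact hpγ (by linarith)
  rw [hu2] at e2 huw hun hm
  have hm2 : m 2 = 0 := by
    by_contra hne
    have hu1 : u' 1 = 0 := by
      have : m 2 * u' 1 = 0 := by linear_combination -e2
      simpa [hne] using this
    rw [hu1] at huw hun
    have hu0 : u' 0 = 0 := by
      have : u' 0 * w 0 = 0 := by linear_combination huw
      simpa [hw] using this
    rw [hu0] at hun
    norm_num at hun
  rw [hm2] at hmw
  have hmp : m = p := by
    have f1 : (m 0 - p 0) * u' 1 - m 1 * u' 0 = 0 := by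
      refine mul_left_cancel₀ hw ?_
      linear_combination u' 1 * hmw - m 1 * huw
    refine E3.ext ?_ ?_ (by rw [hm2, hp2])
    · linear_combination u' 0 * hm + u' 1 * f1 - (m 0 - p 0) * hun
    · linear_combination u' 1 * hm - u' 0 * f1 - m 1 * hun - hp1
  subst hmp
  intro a ha ha2 haw x hx hxw
  have := h.maps x hx hxw
  rcases eq_or_eq_neg_of_planar ha h.unit ha2 hu2 haw h.orth (Or.inl hw) with h | h
  · rwa [h]
  · rwa [h, halfTurn_neg]

/-- The linear parametrization by `ℂ` of the plane spanned by `u` and `v`. -/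
noncomputable def planeMap (u v : E3) (z : ℂ) : E3 := z.re • u + z.im • v

theorem planeMap_add (u v : E3) (z z' : ℂ) :
    planeMap u v (z + z') = planeMap u v z + planeMap u v z' := by
  simp only [planeMap, Complex.add_re, Complex.add_im]; module

theorem planeMap_neg (u v : E3) (z : ℂ) : planeMap u v (-z) = -planeMap u v z := by
  simp only [planeMap, Complex.neg_re, Complex.neg_im]; module

theorem planeMap_sub (u v : E3) (z z' : ℂ) :
    planeMap u v (z - z') = planeMap u v z - planeMap u v z' := by
  simp only [planeMap, Complex.sub_re, Complex.sub_im]; module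

@[simp] theorem planeMap_zero (u v : E3) : planeMap u v 0 = 0 := by simp [planeMap]

theorem continuous_planeMap (u v : E3) : Continuous (planeMap u v) := by
  unfold planeMap; fun_prop

theorem inner_planeMap {u v : E3} (hu : ‖u‖ = 1) (hv : ‖v‖ = 1) (huv : inner ℝ u v = 0)
    (a b : ℂ) : inner ℝ (planeMap u v a) (planeMap u v b) = a.re * b.re + a.im * b.im := by
  simp only [planeMap, inner_add_left, inner_add_right, real_inner_smul_left,
    real_inner_smul_right, huv, real_inner_comm u v, real_inner_self_eq_norm_sq, hu, hv]
  ring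

theorem norm_planeMap {u v : E3} (hu : ‖u‖ = 1) (hv : ‖v‖ = 1) (huv : inner ℝ u v = 0) (z : ℂ) :
    ‖planeMap u v z‖ = ‖z‖ := by
  rw [← sq_eq_sq₀ (norm_nonneg _) (norm_nonneg _), ← real_inner_self_eq_norm_sq,
    inner_planeMap hu hv huv, Complex.sq_norm, Complex.normSq_apply]

/-- In a coordinate of the section plane, the half-turn about an axis is a reflection of `ℂ`. -/
theorem SectionAxis.reflect_mem {K : Set E3} {p w m u u' v : E3} (h : SectionAxis K p w m u')
    (hu : ‖u‖ = 1) (hv : ‖v‖ = 1) (huv : inner ℝ u v = 0) (huw : inner ℝ u w = 0)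
    (hvw : inner ℝ v w = 0) {ζ μ : ℂ} (hζ : u' = planeMap u v ζ) (hμ : m - p = planeMap u v μ)
    {z : ℂ} (hz : p + planeMap u v z ∈ K) :
    p + planeMap u v (ζ ^ 2 * (starRingEnd ℂ) (z - μ) + μ) ∈ K := by
  have hmap := h.maps _ hz (by
    rw [add_sub_cancel_left, planeMap, inner_add_left, real_inner_smul_left, real_inner_smul_left,
      huw, hvw]; ring)
  have hn : ζ.re ^ 2 + ζ.im ^ 2 = 1 := by
    have := h.unit
    rw [hζ, norm_planeMap hu hv huv, ← sq_eq_sq₀ (norm_nonneg _) zero_le_one, Complex.sq_norm,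
      Complex.normSq_apply] at this
    linarith
  obtain rfl : m = p + planeMap u v μ := by rw [← hμ]; abel
  have e : p + planeMap u v z - (p + planeMap u v μ) = planeMap u v (z - μ) := by
    rw [planeMap_sub]; abel
  rw [halfTurn, e, hζ, inner_planeMap hu hv huv] at hmap
  convert hmap using 1
  set c := (z - μ).re * ζ.re + (z - μ).im * ζ.im with hc
  have : ζ ^ 2 * (starRingEnd ℂ) (z - μ) + μ = μ + (μ + ((2 * c : ℝ) : ℂ) * ζ) - z := by
    apply Complex.ext
    · simp [hc, pow_two]
      linear_combination (μ.re - z.re) * hn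
    · simp [hc, pow_two]
      linear_combination (μ.im - z.im) * hn
  rw [this]
  simp only [planeMap, Complex.add_re, Complex.add_im, Complex.sub_re, Complex.sub_im,
    Complex.re_ofReal_mul, Complex.im_ofReal_mul]
  module

/-- The cross product in `E3`. -/
def E3.cross (a b : E3) : E3 :=
  !₂[a 1 * b 2 - a 2 * b 1, a 2 * b 0 - a 0 * b 2, a 0 * b 1 - a 1 * b 0]

theorem E3.inner_cross_left (a b : E3) : inner ℝ a (E3.cross a b) = 0 := by
  simp [E3.inner_eq, E3.cross]; ring

theorem E3.inner_cross_right (a b : E3) : inner ℝ b (E3.cross a b) = 0 := by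
  simp [E3.inner_eq, E3.cross]; ring

theorem E3.norm_cross {a b : E3} (ha : ‖a‖ = 1) (hb : ‖b‖ = 1) (hab : inner ℝ a b = 0) :
    ‖E3.cross a b‖ = 1 := by
  rw [E3.norm_eq_one_iff] at *
  rw [E3.inner_eq] at hab
  simp [E3.cross]
  linear_combination (b 0 ^ 2 + b 1 ^ 2 + b 2 ^ 2) * ha + hb -
    (a 0 * b 0 + a 1 * b 1 + a 2 * b 2) * hab

theorem E3.continuous_cross : Continuous fun x : E3 × E3 => E3.cross x.1 x.2 := by
  unfold E3.cross; fun_prop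

theorem E3.eq_planeMap {u v w x : E3} (hu : ‖u‖ = 1) (hv : ‖v‖ = 1) (hw : ‖w‖ = 1)
    (huv : inner ℝ u v = 0) (huw : inner ℝ u w = 0) (hvw : inner ℝ v w = 0)
    (hx : inner ℝ x w = 0) : x = planeMap u v ⟨inner ℝ x u, inner ℝ x v⟩ := by
  have ho : Orthonormal ℝ ![u, v, w] := by
    constructor
    · intro i; fin_cases i <;> assumption
    · intro i j hij
      fin_cases i <;> fin_cases j <;>
        simp_all [real_inner_comm]
  let b := (basisOfOrthonormalOfCardEqFinrank ho (by simp)).toOrthonormalBasis (by simpa using ho)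
  have hb : ∀ i, b i = ![u, v, w] i := fun i => by simp [b]
  have := b.sum_repr' x
  simp only [Fin.sum_univ_three, hb] at this
  simp only [Matrix.cons_val] at this
  rw [real_inner_comm x w, hx, zero_smul, add_zero, real_inner_comm x u, real_inner_comm x v] at this
  exact this.symm

theorem exists_add_mem_of_pow {S : Set ℂ} {e d : ℂ} (h0 : 0 ∈ S) (h : ∀ z ∈ S, e * z + d ∈ S)
    (N : ℕ) : ∃ d' ∈ S, ∀ z ∈ S, e ^ N * z + d' ∈ S := by
  induction N with
  | zero => exact ⟨0, h0, fun z hz => by simpa using hz⟩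
  | succ N ih =>
    obtain ⟨d', hd', hN⟩ := ih
    refine ⟨e * d' + d, h d' hd', fun z hz => ?_⟩
    have := h _ (hN z hz)
    convert this using 1
    ring

/-- Powers of a unit complex number other than `1` approximate all unit complex numbers, with an
error bounded by the argument. -/
theorem Complex.exists_norm_pow_sub_le {e ε : ℂ} (he : ‖e‖ = 1) (he1 : e ≠ 1) (hε : ‖ε‖ = 1) :
    ∃ N : ℕ, ‖e ^ N - ε‖ ≤ |e.arg| := by
  have hθ : e.arg ≠ 0 := by
    intro h
    apply he1
    rw [← Complex.norm_mul_exp_arg_mul_I e, he, h]; simp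
  have hpi := Real.pi_pos
  obtain ⟨τ, hτ, hτθ⟩ : ∃ τ : ℝ, ε = Complex.exp (τ * Complex.I) ∧ 0 ≤ τ / e.arg := by
    have h0 : ε = Complex.exp (ε.arg * Complex.I) := by
      conv_lhs => rw [← Complex.norm_mul_exp_arg_mul_I ε, hε]
      simp
    rcases lt_or_gt_of_ne hθ with h | h
    · refine ⟨ε.arg - 2 * Real.pi, ?_, div_nonneg_of_nonpos ?_ h.le⟩
      · push_cast
        rw [sub_mul, Complex.exp_sub, Complex.exp_two_pi_mul_I, div_one, ← h0]
      · linarith [Complex.arg_le_pi ε]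
    · refine ⟨ε.arg + 2 * Real.pi, ?_, div_nonneg ?_ h.le⟩
      · push_cast
        rw [add_mul, Complex.exp_add, Complex.exp_two_pi_mul_I, mul_one, ← h0]
      · linarith [Complex.neg_pi_lt_arg ε]
  refine ⟨⌊τ / e.arg⌋₊, ?_⟩
  set N := ⌊τ / e.arg⌋₊
  have h1 : (N : ℝ) ≤ τ / e.arg := Nat.floor_le hτθ
  have h2 : τ / e.arg < N + 1 := Nat.lt_floor_add_one _
  have hpow : e ^ N = Complex.exp (τ * Complex.I) * Complex.exp (Complex.I * (N * e.arg - τ : ℝ)) := by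
    conv_lhs => rw [← Complex.norm_mul_exp_arg_mul_I e, he]
    rw [Complex.ofReal_one, one_mul, ← Complex.exp_nat_mul, ← Complex.exp_add]
    congr 1
    push_cast; ring
  rw [hpow, ← hτ, ← mul_sub_one, norm_mul, hε, one_mul]
  refine Real.norm_exp_I_mul_ofReal_sub_one_le.trans ?_
  have : N * e.arg - τ = e.arg * (N - τ / e.arg) := by field_simp
  rw [this, norm_mul, Real.norm_eq_abs, Real.norm_eq_abs]
  refine mul_le_of_le_one_right (abs_nonneg _) ?_
  rw [abs_le]; constructor <;> linarith

/-- A limit of maps sending plane sections of a convex set into the set sends the limit section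
into the set. -/
theorem section_maps_of_tendsto {K : Set E3} (hK : IsClosed K) (hcv : Convex ℝ K) {p : E3}
    (hp : p ∈ interior K) {w : ℕ → E3} {w' : E3} (hw1 : ∀ k, ‖w k‖ = 1)
    (hw : Tendsto w atTop (𝓝 w')) {G : ℕ → E3 → E3} {G' : E3 → E3} (hG' : Continuous G')
    (hG : ∀ (x : ℕ → E3) (x' : E3), Tendsto x atTop (𝓝 x') →
      Tendsto (fun k => G k (x k)) atTop (𝓝 (G' x')))
    (hmaps : ∀ k, ∀ x ∈ K, inner ℝ (x - p) (w k) = 0 → G k x ∈ K) :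
    ∀ x ∈ K, inner ℝ (x - p) w' = 0 → G' x ∈ K := by
  have hint : ∀ x ∈ interior K, inner ℝ (x - p) w' = 0 → G' x ∈ K := by
    intro x hx hxw
    have ht : Tendsto (fun k => x - inner ℝ (x - p) (w k) • w k) atTop (𝓝 x) := by
      have : Tendsto (fun k => x - inner ℝ (x - p) (w k) • w k) atTop
          (𝓝 (x - inner ℝ (x - p) w' • w')) :=
        tendsto_const_nhds.sub ((tendsto_const_nhds.inner hw).smul hw)
      simpa [hxw] using this
    refine hK.mem_of_tendsto (hG _ x ht) ?_
    filter_upwards [ht.eventually (isOpen_interior.mem_nhds hx)] with k hk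
    refine hmaps k _ (interior_subset hk) ?_
    rw [sub_right_comm, inner_sub_left, real_inner_smul_left, real_inner_self_eq_norm_sq, hw1]
    ring
  intro x hx hxw
  have ht : Tendsto (fun t : ℝ => G' (x + t • (p - x))) (𝓝[>] 0) (𝓝 (G' x)) := by
    have : Tendsto (fun t : ℝ => G' (x + t • (p - x))) (𝓝 0) (𝓝 (G' (x + (0 : ℝ) • (p - x)))) :=
      (by fun_prop : Continuous fun t : ℝ => G' (x + t • (p - x))).tendsto 0
    rw [zero_smul, add_zero] at this
    exact this.mono_left nhdsWithin_le_nhds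
  refine hK.mem_of_tendsto ht ?_
  filter_upwards [Ioc_mem_nhdsGT (zero_lt_one' ℝ)] with t ht
  refine hint _ (hcv.add_smul_sub_mem_interior hx hp ht) ?_
  have : x + t • (p - x) - p = (1 - t) • (x - p) := by module
  rw [this, real_inner_smul_left, hxw, mul_zero]

theorem SectionAxis.of_tendsto {K : Set E3} (hK : IsClosed K) (hcv : Convex ℝ K) {p : E3}
    (hp : p ∈ interior K) {w m u : ℕ → E3} {w' m' u' : E3} (hw1 : ∀ k, ‖w k‖ = 1)
    (hw : Tendsto w atTop (𝓝 w')) (hm : Tendsto m atTop (𝓝 m')) (hu : Tendsto u atTop (𝓝 u'))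
    (h : ∀ k, SectionAxis K p (w k) (m k) (u k)) : SectionAxis K p w' m' u' where
  unit := tendsto_nhds_unique hu.norm (by simp [(h _).unit])
  orth := tendsto_nhds_unique (hu.inner hw) (by simp [(h _).orth])
  mem := tendsto_nhds_unique ((hm.sub_const p).inner hw) (by simp [(h _).mem])
  maps := by
    refine section_maps_of_tendsto hK hcv hp hw1 hw (G := fun k => halfTurn (m k) (u k))
      (continuous_halfTurn m' u') ?_ fun k => (h k).maps
    intro x x' hx
    unfold halfTurn
    exact ((hm.add (((hx.sub hm).inner hu).smul hu)).const_smul _).sub hx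

theorem CoplanarWith.of_tendsto {α β γ : ℝ} {m u : ℕ → E3} {m' u' : E3}
    (hm : Tendsto m atTop (𝓝 m')) (hu : Tendsto u atTop (𝓝 u'))
    (h : ∀ k, CoplanarWith α β γ (m k) (u k)) : CoplanarWith α β γ m' u' := by
  have hc : IsClosed {q : E3 × E3 | CoplanarWith α β γ q.1 q.2} := by
    unfold CoplanarWith
    exact isClosed_eq (by fun_prop) (by fun_prop)
  exact hc.mem_of_tendsto (hm.prodMk_nhds hu) (Eventually.of_forall h)

theorem mem_of_norm_eq_of_tendsto_axes {K : Set E3} (hK : IsCompact K) (hcv : Convex ℝ K)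
    (hneg : ∀ x ∈ K, -x ∈ K) {p : E3} (hp : p ∈ interior K) {w m u m' u' : ℕ → E3} {W U U' : E3}
    (hw1 : ∀ k, ‖w k‖ = 1) (hw : Tendsto w atTop (𝓝 W)) (hpW : inner ℝ p W = 0)
    (hu : Tendsto u atTop (𝓝 U)) (hu' : Tendsto u' atTop (𝓝 U')) (hU : U' = U ∨ U' = -U)
    (h : ∀ k, SectionAxis K p (w k) (m k) (u k)) (h' : ∀ k, SectionAxis K p (w k) (m' k) (u' k))
    (hne : ∀ k, ¬(u' k = u k ∨ u' k = -u k)) {x y : E3} (hx : x ∈ K) (hxW : inner ℝ x W = 0)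
    (hyW : inner ℝ y W = 0) (hxy : ‖y‖ = ‖x‖) : y ∈ K := by
  rcases eq_or_ne x 0 with rfl | hx0
  · rw [norm_zero, norm_eq_zero] at hxy; rwa [hxy]
  have hW1 : ‖W‖ = 1 := tendsto_nhds_unique hw.norm (by simp [hw1])
  have hU1 : ‖U‖ = 1 := tendsto_nhds_unique hu.norm (by simp [(h _).unit])
  have hUW : inner ℝ U W = 0 := tendsto_nhds_unique (hu.inner hw) (by simp [(h _).orth])
  have hpK := interior_subset hp
  let v : ℕ → E3 := fun k => E3.cross (w k) (u k)
  set V := E3.cross W U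
  have hv : Tendsto v atTop (𝓝 V) :=
    (E3.continuous_cross.tendsto (W, U)).comp (hw.prodMk_nhds hu)
  have hwu : ∀ k, inner ℝ (w k) (u k) = 0 := fun k => by rw [real_inner_comm]; exact (h k).orth
  have hv1 : ∀ k, ‖v k‖ = 1 := fun k => E3.norm_cross (hw1 k) (h k).unit (hwu k)
  have huv : ∀ k, inner ℝ (u k) (v k) = 0 := fun k => E3.inner_cross_right _ _
  have hvw : ∀ k, inner ℝ (v k) (w k) = 0 := fun k => by
    rw [real_inner_comm]; exact E3.inner_cross_left _ _
  have hV1 : ‖V‖ = 1 := E3.norm_cross hW1 hU1 (by rwa [real_inner_comm])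
  have hUV : inner ℝ U V = 0 := E3.inner_cross_right _ _
  have hVW : inner ℝ V W = 0 := by rw [real_inner_comm]; exact E3.inner_cross_left _ _
  have hcoord : ∀ k z, inner ℝ z (w k) = 0 →
      z = planeMap (u k) (v k) ⟨inner ℝ z (u k), inner ℝ z (v k)⟩ := fun k z hz =>
    E3.eq_planeMap (h k).unit (hv1 k) (hw1 k) (huv k) (h k).orth (hvw k) hz
  have hCOORD : ∀ z, inner ℝ z W = 0 → z = planeMap U V ⟨inner ℝ z U, inner ℝ z V⟩ := fun z hz =>
    E3.eq_planeMap hU1 hV1 hW1 hUV hUW hVW hz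
  let ζ : ℕ → ℂ := fun k => ⟨inner ℝ (u' k) (u k), inner ℝ (u' k) (v k)⟩
  have hζ : ∀ k, u' k = planeMap (u k) (v k) (ζ k) := fun k => hcoord k _ (h' k).orth
  have hζ1 : ∀ k, ‖ζ k‖ = 1 := fun k => by
    rw [← norm_planeMap (h k).unit (hv1 k) (huv k), ← hζ, (h' k).unit]
  have he1 : ∀ k, ζ k ^ 2 ≠ 1 := fun k hk => by
    apply hne k
    rcases sq_eq_one_iff.1 hk with hk | hk
    · left; rw [hζ k, hk]; simp [planeMap]
    · right; rw [hζ k, hk]; simp [planeMap]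
  have hmk : ∀ {a b : ℕ → ℝ} {a' b' : ℝ}, Tendsto a atTop (𝓝 a') → Tendsto b atTop (𝓝 b') →
      Tendsto (fun k => (⟨a k, b k⟩ : ℂ)) atTop (𝓝 ⟨a', b'⟩) := by
    intro a b a' b' ha hb
    have := (Complex.continuous_ofReal.tendsto a').comp ha |>.add
      (((Complex.continuous_ofReal.tendsto b').comp hb).mul_const Complex.I)
    simpa only [Function.comp_def, ← Complex.mk_eq_add_mul_I] using this
  have he : Tendsto (fun k => ζ k ^ 2) atTop (𝓝 1) := by
    have hlim : Tendsto ζ atTop (𝓝 ⟨inner ℝ U' U, inner ℝ U' V⟩) := hmk (hu'.inner hu) (hu'.inner hv)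
    have := hlim.pow 2
    convert this using 2
    rcases hU with rfl | rfl
    · apply Complex.ext <;> simp [pow_two, hU1, hUV]
    · apply Complex.ext <;> simp [pow_two, hU1, hUV]
  have hrot : ∀ k, ∃ d : ℂ, ∀ z ∈ {z : ℂ | p + planeMap (u k) (v k) z ∈ K},
      ζ k ^ 2 * z + d ∈ {z : ℂ | p + planeMap (u k) (v k) z ∈ K} := by
    intro k
    have hμ := hcoord k _ (h k).mem
    have hμ' := hcoord k _ (h' k).mem
    set μ : ℂ := ⟨inner ℝ (m k - p) (u k), inner ℝ (m k - p) (v k)⟩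
    set μ' : ℂ := ⟨inner ℝ (m' k - p) (u k), inner ℝ (m' k - p) (v k)⟩
    refine ⟨ζ k ^ 2 * (starRingEnd ℂ) ((starRingEnd ℂ) (-μ) + μ - μ') + μ', fun z hz => ?_⟩
    have h1 := (h k).reflect_mem (ζ := 1) (h k).unit (hv1 k) (huv k) (h k).orth (hvw k)
      (by simp [planeMap]) hμ hz
    have h2 := (h' k).reflect_mem (h k).unit (hv1 k) (huv k) (h k).orth (hvw k) (hζ k) hμ' h1
    rw [Set.mem_ofPred_eq]
    convert h2 using 3
    simp only [map_sub, map_add, map_neg, one_pow, one_mul, Complex.conj_conj]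
    ring
  set zx : ℂ := ⟨inner ℝ x U, inner ℝ x V⟩ with hzx
  set zy : ℂ := ⟨inner ℝ y U, inner ℝ y V⟩ with hzy
  have hxz : x = planeMap U V zx := hCOORD x hxW
  have hyz : y = planeMap U V zy := hCOORD y hyW
  have hzx0 : zx ≠ 0 := by rintro h0; rw [h0, planeMap_zero] at hxz; exact hx0 hxz
  have hzn : ‖zy‖ = ‖zx‖ := by
    rw [← norm_planeMap hU1 hV1 hUV, ← norm_planeMap hU1 hV1 hUV zx, ← hxz, ← hyz, hxy]
  have hε : ‖zy / zx‖ = 1 := by rw [norm_div, hzn, div_self (by simpa using hzx0)]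
  have hN : ∀ k, ∃ N : ℕ, ‖(ζ k ^ 2) ^ N - zy / zx‖ ≤ |(ζ k ^ 2).arg| := fun k =>
    Complex.exists_norm_pow_sub_le (by rw [norm_pow, hζ1, one_pow]) (he1 k) hε
  choose N hN using hN
  have harg : Tendsto (fun k => |(ζ k ^ 2).arg|) atTop (𝓝 0) := by
    have := ((Complex.continuousAt_arg (x := 1) (by simp)).tendsto.comp he).abs
    simpa using this
  have hpow : Tendsto (fun k => (ζ k ^ 2) ^ N k) atTop (𝓝 (zy / zx)) :=
    tendsto_iff_norm_sub_tendsto_zero.2 (squeeze_zero (fun _ => norm_nonneg _) hN harg)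
  have hd : ∀ k, ∃ d : ℂ, p + planeMap (u k) (v k) d ∈ K ∧
      ∀ z, p + planeMap (u k) (v k) z ∈ K → p + planeMap (u k) (v k) ((ζ k ^ 2) ^ N k * z + d) ∈ K := by
    intro k
    obtain ⟨d, hd⟩ := hrot k
    exact exists_add_mem_of_pow (by simpa using hpK) hd (N k)
  choose d hdK hd using hd
  obtain ⟨R, hR⟩ := hK.isBounded.exists_norm_le
  obtain ⟨D, -, ψ, hψ, hD⟩ := tendsto_subseq_of_bounded (Metric.isBounded_closedBall (x := (0 : ℂ))
    (r := R + ‖p‖)) (x := d) (fun k => by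
      rw [mem_closedBall_zero_iff, ← norm_planeMap (h k).unit (hv1 k) (huv k)]
      calc ‖planeMap (u k) (v k) (d k)‖ = ‖(p + planeMap (u k) (v k) (d k)) - p‖ := by simp
        _ ≤ _ := (norm_sub_le _ _).trans (by gcongr; exact hR _ (hdK k)))
  have hψt := hψ.tendsto_atTop
  have hlim := section_maps_of_tendsto hK.isClosed hcv hp (w := w ∘ ψ) (fun k => hw1 _)
    (hw.comp hψt)
    (G := fun k z => p + planeMap (u (ψ k)) (v (ψ k)) ((ζ (ψ k) ^ 2) ^ N (ψ k) *
      ⟨inner ℝ (z - p) (u (ψ k)), inner ℝ (z - p) (v (ψ k))⟩ + d (ψ k)))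
    (G' := fun z => p + planeMap U V (zy / zx * ⟨inner ℝ (z - p) U, inner ℝ (z - p) V⟩ + D))
    (by
      have : Continuous fun z : E3 => (⟨inner ℝ (z - p) U, inner ℝ (z - p) V⟩ : ℂ) := by
        simp only [Complex.mk_eq_add_mul_I]; fun_prop
      exact continuous_const.add ((continuous_planeMap U V).comp
        ((continuous_const.mul this).add continuous_const)))
    (by
      intro z z' hz
      have h1 := ((hpow.comp hψt).mul (hmk ((hz.sub_const p).inner (hu.comp hψt))
        ((hz.sub_const p).inner (hv.comp hψt)))).add hD
      have h2 := ((Complex.continuous_re.tendsto _).comp h1).smul (hu.comp hψt)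
      have h3 := ((Complex.continuous_im.tendsto _).comp h1).smul (hv.comp hψt)
      exact (h2.add h3).const_add p)
    (by
      intro k z hz hzw
      refine hd _ _ ?_
      rw [← hcoord _ _ hzw]; simpa using hz)
  have hφW : ∀ z, inner ℝ (planeMap U V z) W = 0 := fun z => by
    rw [planeMap, inner_add_left, real_inner_smul_left, real_inner_smul_left, hUW, hVW]; ring
  have hGeq : ∀ z, p + planeMap U V (zy / zx * ⟨inner ℝ (z - p) U, inner ℝ (z - p) V⟩ + D) =
      (p + planeMap U V (D - zy / zx * ⟨inner ℝ p U, inner ℝ p V⟩)) +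
        planeMap U V (zy / zx * ⟨inner ℝ z U, inner ℝ z V⟩) := fun z => by
    rw [add_assoc, ← planeMap_add, inner_sub_left, inner_sub_left]
    have : (⟨inner ℝ z U - inner ℝ p U, inner ℝ z V - inner ℝ p V⟩ : ℂ) =
      ⟨inner ℝ z U, inner ℝ z V⟩ - ⟨inner ℝ p U, inner ℝ p V⟩ := by apply Complex.ext <;> simp
    rw [this]; congr 2; ring
  have hS : IsCompact (K ∩ {z | inner ℝ z W = 0}) :=
    hK.inter_right (isClosed_eq (by fun_prop) continuous_const)
  have hc := eq_zero_of_add_mem hS ⟨p, hpK, hpW⟩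
    (fun z hz => ⟨hneg z hz.1, by
      have : inner ℝ z W = 0 := hz.2
      simpa using this⟩)
    (c := p + planeMap U V (D - zy / zx * ⟨inner ℝ p U, inner ℝ p V⟩))
    (A := fun z => planeMap U V (zy / zx * ⟨inner ℝ z U, inner ℝ z V⟩))
    (fun z => by
      rw [← planeMap_neg, inner_neg_left, inner_neg_left]; congr 1
      rw [← mul_neg]; rfl)
    (fun z hz => by
      rw [norm_planeMap hU1 hV1 hUV, norm_mul, hε, one_mul, ← norm_planeMap hU1 hV1 hUV,
        ← hCOORD z hz.2])
    (by
      rintro z ⟨hz, hzW⟩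
      have hzW : inner ℝ z W = 0 := hzW
      have := hlim z hz (by rw [inner_sub_left, hzW, hpW, sub_zero])
      rw [← hGeq]
      refine ⟨this, ?_⟩
      change inner ℝ _ W = 0
      rw [inner_add_left, hpW, hφW, add_zero])
  have := hlim x hx (by rw [inner_sub_left, hxW, hpW, sub_zero])
  rw [hGeq, hc, zero_add, ← hzx, div_mul_cancel₀ _ hzx0, ← hyz] at this
  exact this

/-- If sections by planes `w k` converging to a plane `W` through `0` and `p` do not have their
trace on `{z = 0}` as an axis, then the section by `W` is invariant under rotations about `0`. -/
theorem mem_of_norm_eq_of_not_hasTraceAxis {K : Set E3} (hK : IsCompact K) (hcv : Convex ℝ K)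
    (hneg : ∀ x ∈ K, -x ∈ K) {p : E3} (hp : p ∈ interior K) (hp1 : p 1 = 0)
    (hp2 : p 2 = 0) {α β γ : ℝ} (hβ : β ≠ 0) (hγ : γ ≠ 0) (hpγ : α * p 0 ≠ γ)
    (hH : HasCoplanarAxes K p α β γ) (hH' : HasCoplanarAxes K p α (-β) γ)
    {w : ℕ → E3} {W : E3} (hw1 : ∀ k, ‖w k‖ = 1) (hw : Tendsto w atTop (𝓝 W))
    (hw0 : ∀ k, w k 0 ≠ 0) (hW0 : W 0 = 0) (hW1 : W 1 ≠ 0)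
    (hn : ∀ k, ¬HasTraceAxis K p (w k)) {x y : E3} (hx : x ∈ K) (hxW : inner ℝ x W = 0)
    (hyW : inner ℝ y W = 0) (hxy : ‖y‖ = ‖x‖) : y ∈ K := by
  have hpK := interior_subset hp
  have h0 : (0 : E3) ∈ K := by
    have := hcv.midpoint_mem hpK (hneg p hpK)
    simpa using this
  have hw0' : ∀ k, w k ≠ 0 := fun k h => by simpa [h] using hw1 k
  choose m hm u hax hc hf using fun k => hH.exists_foot hcv hpK (hw0' k)
  choose m' hm' u' hax' hc' hf' using fun k => hH'.exists_foot hcv hpK (hw0' k)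
  have hne : ∀ k, ¬(u' k = u k ∨ u' k = -u k) := fun k h =>
    hn k (hasTraceAxis_of_parallel hK hpK hp1 hp2 hβ hpγ (hw0 k) (hax k) (hc k) (hf k) (hax' k)
      (hc' k) (hf' k) h)
  have hpW : inner ℝ p W = 0 := by rw [E3.inner_eq, hp1, hp2, hW0]; ring
  have hcpt : IsCompact ((K ×ˢ Metric.sphere (0 : E3) 1) ×ˢ (K ×ˢ Metric.sphere (0 : E3) 1)) :=
    (hK.prod (isCompact_sphere 0 1)).prod (hK.prod (isCompact_sphere 0 1))
  obtain ⟨⟨⟨M, U⟩, ⟨M', U'⟩⟩, -, φ, hφ, hlim⟩ := hcpt.tendsto_subseq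
    (x := fun k => ((m k, u k), (m' k, u' k))) (fun k => ⟨⟨hm k, by simpa using (hax k).unit⟩,
      ⟨hm' k, by simpa using (hax' k).unit⟩⟩)
  have hφt := hφ.tendsto_atTop
  have hM : Tendsto (fun k => m (φ k)) atTop (𝓝 M) := hlim.fst_nhds.fst_nhds
  have hU : Tendsto (fun k => u (φ k)) atTop (𝓝 U) := hlim.fst_nhds.snd_nhds
  have hM' : Tendsto (fun k => m' (φ k)) atTop (𝓝 M') := hlim.snd_nhds.fst_nhds
  have hU' : Tendsto (fun k => u' (φ k)) atTop (𝓝 U') := hlim.snd_nhds.snd_nhds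
  have hwφ : Tendsto (fun k => w (φ k)) atTop (𝓝 W) := hw.comp hφt
  have hA := SectionAxis.of_tendsto hK.isClosed hcv hp (fun k => hw1 (φ k)) hwφ hM hU
    fun k => hax (φ k)
  have hA' := SectionAxis.of_tendsto hK.isClosed hcv hp (fun k => hw1 (φ k)) hwφ hM' hU'
    fun k => hax' (φ k)
  have hU2 := hA.direction_eq hK h0 hneg hpW hγ
    (CoplanarWith.of_tendsto hM hU fun k => hc (φ k))
  have hU2' := hA'.direction_eq hK h0 hneg hpW hγ
    (CoplanarWith.of_tendsto hM' hU' fun k => hc' (φ k))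
  exact mem_of_norm_eq_of_tendsto_axes hK hcv hneg hp (fun k => hw1 (φ k)) hwφ hpW hU hU'
    (eq_or_eq_neg_of_planar hA'.unit hA.unit hU2' hU2 hA'.orth hA.orth (Or.inr hW1))
    (fun k => hax (φ k)) (fun k => hax' (φ k)) (fun k => hne (φ k)) hx hxW hyW hxy

/-- The rotation of `y` about the vertical axis through `p`, by twice the angle with tangent `-τ`. -/
noncomputable def swing (p y : E3) (τ : ℝ) : E3 :=
  !₂[y 0 + 2 * (τ * y 1 - τ ^ 2 * (y 0 - p 0)) / (1 + τ ^ 2),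
    y 1 - 2 * (τ * (y 0 - p 0) + τ ^ 2 * y 1) / (1 + τ ^ 2), y 2]

theorem HasTraceAxis.swing_mem {K : Set E3} {p w : E3} (h : HasTraceAxis K p w) (hp1 : p 1 = 0)
    (hp2 : p 2 = 0) (hK : ∀ x ∈ K, x.flip ∈ K) {τ : ℝ} (hw : w 0 + τ * w 1 = 0) {y : E3}
    (hy : y ∈ K) (hyw : inner ℝ (y - p) w = 0) : swing p y τ ∈ K := by
  have hpos : 0 < 1 + τ ^ 2 := by positivity
  have hs : Real.sqrt (1 + τ ^ 2) ^ 2 = 1 + τ ^ 2 := Real.sq_sqrt hpos.le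
  have hs0 : Real.sqrt (1 + τ ^ 2) ≠ 0 := (Real.sqrt_pos.2 hpos).ne'
  set r := Real.sqrt (1 + τ ^ 2)
  have := hK _ (h !₂[r⁻¹, τ * r⁻¹, 0] (by
    rw [E3.norm_eq_one_iff]
    simp only [Matrix.cons_val]
    field_simp
    linarith) rfl (by
    rw [E3.inner_eq]
    simp only [Matrix.cons_val]
    linear_combination r⁻¹ * hw) y hy hyw)
  convert this using 1
  have hr : r⁻¹ * r⁻¹ = (1 + τ ^ 2)⁻¹ := by rw [← hs, pow_two, mul_inv]
  have hd : (1 + τ ^ 2) * (1 + τ ^ 2)⁻¹ = 1 := mul_inv_cancel₀ hpos.ne'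
  refine E3.ext ?_ ?_ ?_
  · simp only [swing, E3.flip_apply_zero, halfTurn_apply, E3.inner_eq, Matrix.cons_val,
      PiLp.toLp_apply, PiLp.sub_apply, hp1, div_eq_mul_inv]
    linear_combination -2 * (y 0 - p 0 + τ * y 1) * hr - 2 * (y 0 - p 0) * hd
  · simp only [swing, E3.flip_apply_one, halfTurn_apply, E3.inner_eq, Matrix.cons_val,
      PiLp.toLp_apply, PiLp.sub_apply, hp1, div_eq_mul_inv]
    linear_combination 2 * τ * (y 0 - p 0 + τ * y 1) * hr
  · simp [swing, halfTurn_apply, hp2]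

theorem eq_zero_of_eventually_mul_nonpos {A B : ℝ}
    (h : ∀ᶠ τ : ℝ in 𝓝[≠] 0, τ * (A + τ * B) ≤ 0) : A = 0 := by
  have ht : Tendsto (fun τ : ℝ => A + τ * B) (𝓝 0) (𝓝 A) := by
    have : Tendsto (fun τ : ℝ => A + τ * B) (𝓝 0) (𝓝 (A + 0 * B)) :=
      (by fun_prop : Continuous fun τ : ℝ => A + τ * B).tendsto 0
    simpa using this
  refine le_antisymm ?_ ?_
  · refine le_of_tendsto (ht.mono_left (nhdsWithin_le_nhds (s := Set.Ioi 0))) ?_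
    filter_upwards [h.filter_mono (nhdsWithin_mono 0 fun x (hx : 0 < x) => hx.ne'),
      self_mem_nhdsWithin] with τ h1 (h2 : 0 < τ)
    by_contra! h3
    exact absurd h1 (not_le.2 (mul_pos h2 h3))
  · refine ge_of_tendsto (ht.mono_left (nhdsWithin_le_nhds (s := Set.Iio 0))) ?_
    filter_upwards [h.filter_mono (nhdsWithin_mono 0 fun x (hx : x < 0) => hx.ne),
      self_mem_nhdsWithin] with τ h1 (h2 : τ < 0)
    by_contra! h3
    exact absurd h1 (not_le.2 (mul_pos_of_neg_of_neg h2 h3))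

theorem swing_slope {p y ν : E3} (h : ∀ᶠ τ : ℝ in 𝓝[≠] 0, inner ℝ ν (swing p y τ) ≤ inner ℝ ν y) :
    ν 0 * y 1 - ν 1 * (y 0 - p 0) = 0 := by
  refine eq_zero_of_eventually_mul_nonpos (B := -(ν 0 * (y 0 - p 0)) - ν 1 * y 1) ?_
  filter_upwards [h] with τ hτ
  have hpos : 0 < 1 + τ ^ 2 := by positivity
  simp only [E3.inner_eq, swing, Matrix.cons_val] at hτ
  have e : ν 0 * (2 * (τ * y 1 - τ ^ 2 * (y 0 - p 0)) / (1 + τ ^ 2)) -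
      ν 1 * (2 * (τ * (y 0 - p 0) + τ ^ 2 * y 1) / (1 + τ ^ 2)) ≤ 0 := by linarith
  have e2 : ν 0 * (2 * (τ * y 1 - τ ^ 2 * (y 0 - p 0)) / (1 + τ ^ 2)) -
      ν 1 * (2 * (τ * (y 0 - p 0) + τ ^ 2 * y 1) / (1 + τ ^ 2)) =
      2 * (τ * (ν 0 * y 1 - ν 1 * (y 0 - p 0) + τ * (-(ν 0 * (y 0 - p 0)) - ν 1 * y 1))) /
        (1 + τ ^ 2) := by ring
  rw [e2, div_le_iff₀ hpos] at e
  linarith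

/-- If a strictly convex set that is symmetric in the plane `{x = 0}` contains small horizontal
circular arcs around `p` through `y` and through the mirror image of `y`, then `y` is an interior
point. -/
theorem mem_interior_of_eventually_swing_mem {K : Set E3}
    (hsc : StrictConvex ℝ K) (hint : (interior K).Nonempty) {p y : E3} (hp0 : p 0 ≠ 0)
    (hy1 : y 1 ≠ 0) (hy : y ∈ K) (hmir : ∀ x ∈ K, -x.flip ∈ K)
    (h : ∀ᶠ τ : ℝ in 𝓝[≠] 0, swing p y τ ∈ K)
    (h' : ∀ᶠ τ : ℝ in 𝓝[≠] 0, swing p (-y.flip) τ ∈ K) : y ∈ interior K := by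
  by_contra hyi
  obtain ⟨f, hf⟩ := geometric_hahn_banach_open_point hsc.convex.interior isOpen_interior hyi
  obtain ⟨ν, hν⟩ : ∃ ν : E3, ∀ x, f x = inner ℝ ν x :=
    ⟨(InnerProductSpace.toDual ℝ E3).symm f, fun x => by simp⟩
  have hle : ∀ x ∈ K, inner ℝ ν x ≤ inner ℝ ν y := by
    have hsub : K ⊆ {x | inner ℝ ν x ≤ inner ℝ ν y} := by
      calc K ⊆ closure K := subset_closure
        _ = closure (interior K) :=
          (hsc.convex.closure_interior_eq_closure_of_nonempty_interior hint).symm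
        _ ⊆ _ := closure_minimal (fun x hx => by
            have := (hf x hx).le
            rwa [hν, hν] at this) (isClosed_le (by fun_prop) continuous_const)
    exact hsub
  have s1 := swing_slope (ν := ν) (h.mono fun τ hτ => hle _ hτ)
  have s2 := swing_slope (p := p) (y := -y.flip) (ν := -ν.flip) (h'.mono fun τ hτ => by
    have := hle _ (hmir _ hτ)
    simp only [E3.inner_eq, PiLp.neg_apply, E3.flip_apply_zero, E3.flip_apply_one,
      E3.flip_apply_two] at *
    linarith)
  simp only [PiLp.neg_apply, E3.flip_apply_zero, E3.flip_apply_one] at s2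
  have hν1 : ν 1 = 0 := by
    have : ν 1 * p 0 = 0 := by linear_combination (s1 + s2) / 2
    simpa [hp0] using this
  have hν0 : ν 0 = 0 := by
    rw [hν1] at s1
    have : ν 0 * y 1 = 0 := by linear_combination s1
    simpa [hy1] using this
  have hne : ∀ᶠ τ : ℝ in 𝓝[≠] 0, y 1 - τ * (y 0 - p 0) ≠ 0 := by
    have : Tendsto (fun τ : ℝ => y 1 - τ * (y 0 - p 0)) (𝓝 0) (𝓝 (y 1 - 0 * (y 0 - p 0))) :=
      (by fun_prop : Continuous fun τ : ℝ => y 1 - τ * (y 0 - p 0)).tendsto 0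
    rw [zero_mul, sub_zero] at this
    exact (this.eventually_ne hy1).filter_mono nhdsWithin_le_nhds
  obtain ⟨τ, ⟨hτ, hτne⟩, hτ0⟩ := ((h.and hne).and self_mem_nhdsWithin).exists
  have hτ0 : τ ≠ 0 := hτ0
  have hpos : 0 < 1 + τ ^ 2 := by positivity
  have hzy : swing p y τ ≠ y := by
    intro he
    have := congrArg (fun x : E3 => x 0) he
    simp only [swing, Matrix.cons_val, PiLp.toLp_apply, add_eq_left, div_eq_zero_iff, hpos.ne',
      or_false] at this
    have : τ * (y 1 - τ * (y 0 - p 0)) = 0 := by linear_combination this / 2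
    simp [hτ0, hτne] at this
  have hmid := hsc.openSegment_subset hτ hy hzy
    (⟨1 / 2, 1 / 2, by norm_num, by norm_num, by norm_num, rfl⟩ : _ ∈ openSegment ℝ _ _)
  have := hf _ hmid
  rw [hν, hν] at this
  simp only [E3.inner_eq, hν0, hν1, swing, PiLp.add_apply, PiLp.smul_apply, smul_eq_mul,
    Matrix.cons_val] at this
  linarith

theorem exists_smul_mem_notMem_interior {K : Set E3} (hK : IsCompact K) {x : E3} (hx : x ∈ K)
    (hx0 : x ≠ 0) : ∃ t : ℝ, 0 < t ∧ t • x ∈ K ∧ t • x ∉ interior K := by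
  have hcpt : IsCompact ((fun t : ℝ => t • x) ⁻¹' K) :=
    (isClosedEmbedding_smul_left hx0).isCompact_preimage hK
  obtain ⟨t, ht, hmax⟩ := hcpt.exists_isGreatest ⟨1, by simpa using hx⟩
  have h1 : 1 ≤ t := hmax (by simpa using hx)
  refine ⟨t, by linarith, ht, fun hi => ?_⟩
  have hlim : Tendsto (fun s : ℝ => s • x) (𝓝[>] t) (𝓝 (t • x)) :=
    ((by fun_prop : Continuous fun s : ℝ => s • x).tendsto t).mono_left nhdsWithin_le_nhds
  obtain ⟨s, hs, hst⟩ :=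
    ((hlim.eventually (isOpen_interior.mem_nhds hi)).and self_mem_nhdsWithin).exists
  exact absurd (hmax (show s • x ∈ K from interior_subset hs)) (not_le.2 hst)

/-- The section of `K` by the plane through `0` with normal vector `W` is a disc around `0`. -/
def IsDiscSection (K : Set E3) (W : E3) : Prop :=
  ∀ x ∈ K, inner ℝ x W = 0 → ∀ y : E3, inner ℝ y W = 0 → ‖y‖ = ‖x‖ → y ∈ K

theorem eventually_swing_mem {K : Set E3} (hK : IsCompact K) (hcv : Convex ℝ K)
    (hneg : ∀ x ∈ K, -x ∈ K) (hflip : ∀ x ∈ K, x.flip ∈ K) {p : E3} (hp : p ∈ interior K)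
    (hp1 : p 1 = 0) (hp2 : p 2 = 0) {α β γ : ℝ} (hβ : β ≠ 0) (hγ : γ ≠ 0) (hpγ : α * p 0 ≠ γ)
    (hH : HasCoplanarAxes K p α β γ) {y : E3} (hy : y ∈ K) (hy2 : y 2 ≠ 0)
    (hD : ¬IsDiscSection K !₂[0, -y 2, y 1]) : ∀ᶠ τ : ℝ in 𝓝[≠] 0, swing p y τ ∈ K := by
  let ω : ℝ → E3 := fun τ => !₂[τ * y 2, -y 2, y 1 - τ * (y 0 - p 0)]
  have hω0 : ∀ τ, ω τ 0 = τ * y 2 := fun τ => rfl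
  have hω1 : ∀ τ, ω τ 1 = -y 2 := fun τ => rfl
  have hω2 : ∀ τ, ω τ 2 = y 1 - τ * (y 0 - p 0) := fun τ => rfl
  have hωne : ∀ τ, ω τ ≠ 0 := fun τ h => hy2 (by simpa [hω1] using congrArg (fun x : E3 => x 1) h)
  have hωn : ∀ τ, ‖ω τ‖ ≠ 0 := fun τ => by simpa using hωne τ
  have hωc : Continuous ω := by fun_prop
  let w : ℝ → E3 := fun τ => ‖ω τ‖⁻¹ • ω τ
  have hwc : Continuous w := (hωc.norm.inv₀ hωn).smul hωc
  by_contra hev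
  have hfr : ∃ᶠ τ : ℝ in 𝓝[≠] 0, ¬HasTraceAxis K p (w τ) := by
    intro h
    apply hev
    filter_upwards [h] with τ hτ
    refine HasTraceAxis.swing_mem (not_not.1 hτ) hp1 hp2 hflip ?_ hy ?_
    · simp only [w, PiLp.smul_apply, smul_eq_mul, hω0, hω1]; ring
    · rw [real_inner_smul_right, E3.inner_eq, hω0, hω1, hω2]
      simp only [PiLp.sub_apply, hp1, hp2]; ring
  obtain ⟨τ, hτ, hτn⟩ :=
    exists_seq_forall_of_frequently (hfr.and_eventually self_mem_nhdsWithin)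
  have hωW : ω 0 = !₂[0, -y 2, y 1] := by simp [ω]
  have hWin : ∀ x : E3, inner ℝ x !₂[0, -y 2, y 1] = 0 → inner ℝ x (w 0) = 0 := fun x hx => by
    rw [real_inner_smul_right, hωW, hx, mul_zero]
  apply hD
  intro a ha haW b hbW hab
  refine mem_of_norm_eq_of_not_hasTraceAxis hK hcv hneg hp hp1 hp2 hβ hγ hpγ hH
    (hH.flip hflip hp1 hp2) (w := fun k => w (τ k)) (W := w 0) (fun k => ?_)
    ((hwc.tendsto 0).comp (hτ.mono_right nhdsWithin_le_nhds)) (fun k => ?_) ?_ ?_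
    (fun k => (hτn k).1) ha (hWin a haW) (hWin b hbW) hab
  · rw [norm_smul, norm_inv, norm_norm, inv_mul_cancel₀ (hωn _)]
  · have : τ k ≠ 0 := (hτn k).2
    simp only [w, PiLp.smul_apply, smul_eq_mul, hω0]
    exact mul_ne_zero (inv_ne_zero (hωn _)) (mul_ne_zero this hy2)
  · simp [w, hω0]
  · simp only [w, PiLp.smul_apply, smul_eq_mul, hω1]
    exact mul_ne_zero (inv_ne_zero (hωn _)) (neg_ne_zero.2 hy2)

theorem isDiscSection_of_hasCoplanarAxes {K : Set E3} (hK : IsCompact K) (hsc : StrictConvex ℝ K)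
    (hneg : ∀ x ∈ K, -x ∈ K) (hflip : ∀ x ∈ K, x.flip ∈ K) {p : E3} (hp : p ∈ interior K)
    (hp0 : p 0 ≠ 0) (hp1 : p 1 = 0) (hp2 : p 2 = 0) {α β γ : ℝ} (hβ : β ≠ 0) (hγ : γ ≠ 0)
    (hpγ : α * p 0 ≠ γ) (hH : HasCoplanarAxes K p α β γ) {x : E3} (hx : x ∈ K) (hx1 : x 1 ≠ 0)
    (hx2 : x 2 ≠ 0) : IsDiscSection K !₂[0, -x 2, x 1] := by
  by_contra hD
  obtain ⟨t, ht, htK, hti⟩ :=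
    exists_smul_mem_notMem_interior hK hx (by rintro rfl; simp at hx1)
  have hscale : ∀ y : E3, y 1 = t * x 1 → y 2 = t * x 2 →
      ¬IsDiscSection K !₂[0, -y 2, y 1] := fun y h1 h2 h => by
    apply hD
    have e : (!₂[0, -y 2, y 1] : E3) = t • !₂[0, -x 2, x 1] := by
      refine E3.ext ?_ ?_ ?_ <;> simp [h1, h2]
    intro a ha haW b hbW hab
    exact h a ha (by rw [e, real_inner_smul_right, haW, mul_zero]) b
      (by rw [e, real_inner_smul_right, hbW, mul_zero]) hab
  refine hti (mem_interior_of_eventually_swing_mem hsc ⟨p, hp⟩ hp0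
    (by simpa [ht.ne'] using hx1) htK (fun y hy => hneg _ (hflip y hy)) ?_ ?_)
  · exact eventually_swing_mem hK hsc.convex hneg hflip hp hp1 hp2 hβ hγ hpγ hH htK
      (by simpa [ht.ne'] using hx2) (hscale _ (by simp) (by simp))
  · exact eventually_swing_mem hK hsc.convex hneg hflip hp hp1 hp2 hβ hγ hpγ hH
      (hneg _ (hflip _ htK)) (by simpa [ht.ne'] using hx2) (hscale _ (by simp) (by simp))

theorem HasCoplanarAxes.eq_closedBall {K : Set E3} (hK : IsCompact K) (hsc : StrictConvex ℝ K)
    (hneg : ∀ x ∈ K, -x ∈ K) {p : E3} (hp : p ∈ interior K) (hp0 : p 0 ≠ 0) (hp1 : p 1 = 0)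
    (hp2 : p 2 = 0) {α β γ : ℝ} (hβ : β ≠ 0) (hγ : γ ≠ 0) (hpγ : α * p 0 ≠ γ)
    (hH : HasCoplanarAxes K p α β γ) : ∃ r : ℝ, 0 < r ∧ K = Metric.closedBall 0 r := by
  have hcv := hsc.convex
  have hpK := interior_subset hp
  have h0 : (0 : E3) ∈ K := by
    have := hcv.midpoint_mem hpK (hneg p hpK)
    simpa using this
  set e : E3 := EuclideanSpace.single 0 1 with he
  have he1 : ‖e‖ = 1 := by simp [he]
  have hpe : p = p 0 • e := by refine E3.ext ?_ ?_ ?_ <;> simp [he, hp1, hp2]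
  have hflip : ∀ x ∈ K, x.flip ∈ K := fun x hx => by
    rw [E3.flip_eq_halfTurn]
    exact hH.halfTurn_mem hK hcv ⟨p, hp⟩ h0 hneg hγ he1 (by simp [he]) hpe x hx
  have hcpt : IsCompact ((fun t : ℝ => t • e) ⁻¹' K) :=
    (isClosedEmbedding_smul_left (by rintro h; simp [h] at he1)).isCompact_preimage hK
  obtain ⟨r, hr, hmax⟩ := hcpt.exists_isGreatest ⟨0, by simpa using h0⟩
  have hr0 : 0 < r := by
    refine lt_of_lt_of_le (abs_pos.2 hp0) (hmax ?_)
    change |p 0| • e ∈ K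
    rcases abs_choice (p 0) with h | h
    · rwa [h, ← hpe]
    · rw [h, neg_smul, ← hpe]; exact hneg p hpK
  have hle : ∀ t : ℝ, 0 ≤ t → (t • e ∈ K ↔ t ≤ r) := fun t ht => by
    refine ⟨fun h => hmax h, fun h => ?_⟩
    have := hcv.smul_mem_of_zero_mem h0 hr (t := t / r)
      ⟨by positivity, (div_le_one hr0).2 h⟩
    simpa [smul_smul, hr0.ne'] using this
  have hdisc : ∀ x : E3, x 1 ≠ 0 → x 2 ≠ 0 → IsDiscSection K !₂[0, -x 2, x 1] := fun x h1 h2 => by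
    obtain ⟨s, hs, hsK⟩ : ∃ s : ℝ, 0 < s ∧ s • x ∈ K := by
      have hi : (0 : E3) ∈ interior K := by
        have := hcv.openSegment_interior_self_subset_interior hp (hneg p hpK)
          (⟨1 / 2, 1 / 2, by norm_num, by norm_num, by norm_num, rfl⟩ : _ ∈ openSegment ℝ _ _)
        simpa using this
      have ht : Tendsto (fun s : ℝ => s • x) (𝓝[>] 0) (𝓝 ((0 : ℝ) • x)) :=
        ((by fun_prop : Continuous fun s : ℝ => s • x).tendsto 0).mono_left nhdsWithin_le_nhds
      rw [zero_smul] at ht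
      obtain ⟨s, hs, hs0⟩ :=
        ((ht.eventually (isOpen_interior.mem_nhds hi)).and self_mem_nhdsWithin).exists
      exact ⟨s, hs0, interior_subset hs⟩
    have h := isDiscSection_of_hasCoplanarAxes hK hsc hneg hflip hp hp0 hp1 hp2 hβ hγ hpγ hH hsK
      (by simpa [hs.ne'] using h1) (by simpa [hs.ne'] using h2)
    have e : (!₂[0, -(s • x) 2, (s • x) 1] : E3) = s • !₂[0, -x 2, x 1] := by
      refine E3.ext ?_ ?_ ?_ <;> simp
    intro a ha haW b hbW hab
    exact h a ha (by rw [e, real_inner_smul_right, haW, mul_zero]) b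
      (by rw [e, real_inner_smul_right, hbW, mul_zero]) hab
  have hiff : ∀ x : E3, x 1 ≠ 0 → x 2 ≠ 0 → (x ∈ K ↔ ‖x‖ ≤ r) := fun x h1 h2 => by
    rw [← hle _ (norm_nonneg x)]
    have hxW : inner ℝ x (!₂[0, -x 2, x 1] : E3) = 0 := by simp [E3.inner_eq]; ring
    have heW : inner ℝ (‖x‖ • e) (!₂[0, -x 2, x 1] : E3) = 0 := by simp [E3.inner_eq, he]
    have hn : ‖‖x‖ • e‖ = ‖x‖ := by rw [norm_smul, norm_norm, he1, mul_one]
    exact ⟨fun h => hdisc x h1 h2 x h hxW _ heW hn, fun h => hdisc x h1 h2 _ h heW x hxW hn.symm⟩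
  refine ⟨r, hr0, Set.Subset.antisymm ?_ ?_⟩
  · refine hcv.subset_of_generic_subset Metric.isClosed_closedBall ⟨p, hp⟩ fun x hx h1 h2 => ?_
    rw [mem_closedBall_zero_iff]
    exact (hiff x h1 h2).1 hx
  · refine (convex_closedBall 0 r).subset_of_generic_subset hK.isClosed
      ⟨0, Metric.ball_subset_interior_closedBall (Metric.mem_ball_self hr0)⟩ fun x hx h1 h2 => ?_
    rw [mem_closedBall_zero_iff] at hx
    exact (hiff x h1 h2).2 hx

theorem exists_unit_span_of_finrank_eq_one {S : Submodule ℝ E3} (h : Module.finrank ℝ S = 1) :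
    ∃ u : E3, ‖u‖ = 1 ∧ S = Submodule.span ℝ {u} := by
  obtain ⟨v, hv0, hv⟩ := finrank_eq_one_iff'.1 h
  have hv0' : (v : E3) ≠ 0 := by simpa using hv0
  have hS : S = Submodule.span ℝ {(v : E3)} := by
    refine le_antisymm (fun x hx => ?_) (by simp)
    obtain ⟨c, hc⟩ := hv ⟨x, hx⟩
    exact Submodule.mem_span_singleton.2 ⟨c, congrArg Subtype.val hc⟩
  refine ⟨‖(v : E3)‖⁻¹ • (v : E3), ?_, ?_⟩
  · rw [norm_smul, norm_inv, norm_norm, inv_mul_cancel₀ (by simpa using hv0')]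
  · refine hS.trans (Submodule.span_singleton_smul_eq ?_ _).symm
    exact isUnit_iff_ne_zero.2 (inv_ne_zero (by simpa using hv0'))

theorem IsLine.exists_unit_direction {L : AffineSubspace ℝ E3} (hL : IsLine L) {l : E3}
    (hl : l ∈ L) : ∃ d : E3, ‖d‖ = 1 ∧ L.direction = Submodule.span ℝ {d} ∧
      ∀ x, x ∈ L ↔ ∃ t : ℝ, x = l + t • d := by
  obtain ⟨d, hd, hS⟩ := exists_unit_span_of_finrank_eq_one hL.2
  refine ⟨d, hd, hS, fun x => ?_⟩
  rw [← AffineSubspace.vsub_right_mem_direction_iff_mem hl, hS, Submodule.mem_span_singleton,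
    vsub_eq_sub]
  refine exists_congr fun t => ?_
  rw [eq_sub_iff_add_eq, add_comm, eq_comm]

theorem mem_normal_plane_iff {p n x : E3} :
    x ∈ AffineSubspace.mk' p (ℝ ∙ n)ᗮ ↔ inner ℝ (x - p) n = 0 := by
  rw [AffineSubspace.mem_mk', vsub_eq_sub, Submodule.mem_orthogonal_singleton_iff_inner_left]

theorem isPlane_normal_plane (p : E3) {n : E3} (hn : n ≠ 0) :
    IsPlane (AffineSubspace.mk' p (ℝ ∙ n)ᗮ) := by
  refine ⟨⟨p, AffineSubspace.self_mem_mk' _ _⟩, ?_⟩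
  rw [AffineSubspace.direction_mk']
  have := Submodule.finrank_add_finrank_orthogonal (ℝ ∙ n)
  rw [finrank_span_singleton hn, finrank_euclideanSpace_fin] at this
  omega

theorem IsLineOfSymmetry.exists_sectionAxis {M : AffineSubspace ℝ E3} {K : Set E3} {p n m : E3}
    (h : IsLineOfSymmetry M (AffineSubspace.mk' p (ℝ ∙ n)ᗮ) K) (hm : m ∈ M) :
    ∃ u : E3, M.direction = Submodule.span ℝ {u} ∧ SectionAxis K p n m u := by
  obtain ⟨hM, hMP, hne, hrefl⟩ := h
  obtain ⟨u, hu, hS, hmem⟩ := hM.exists_unit_direction hm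
  have hmp := mem_normal_plane_iff.1 (hMP hm)
  refine ⟨u, hS, hu, ?_, hmp, fun x hx hxn => ?_⟩
  · have := mem_normal_plane_iff.1 (hMP ((hmem (m + u)).2 ⟨1, by simp⟩))
    rw [add_sub_right_comm, inner_add_left, hmp, zero_add] at this
    exact this
  · have hx' : EuclideanGeometry.reflection M x ∈
        ((AffineSubspace.mk' p (ℝ ∙ n)ᗮ : AffineSubspace ℝ E3) : Set E3) ∩ K := by
      rw [← hrefl]
      exact ⟨x, ⟨mem_normal_plane_iff.2 hxn, hx⟩, rfl⟩
    convert hx'.2 using 1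
    rw [EuclideanGeometry.reflection_apply_of_mem M x hm]
    have : M.direction.starProjection (x - m) = inner ℝ (x - m) u • u := by
      simp only [hS]
      rw [Submodule.starProjection_unit_singleton ℝ hu, real_inner_comm]
    rw [Submodule.reflection_apply, vsub_eq_sub, this, halfTurn, vadd_eq_add]
    module

/-- The coordinate system with origin `o` and orthonormal basis `b`. -/
noncomputable def frameMap (b : OrthonormalBasis (Fin 3) ℝ E3) (o : E3) : E3 ≃ᵃⁱ[ℝ] E3 :=
  b.repr.symm.toAffineIsometryEquiv.trans (AffineIsometryEquiv.constVAdd ℝ E3 o)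

theorem frameMap_apply (b : OrthonormalBasis (Fin 3) ℝ E3) (o y : E3) :
    frameMap b o y = o + b.repr.symm y := by
  simp [frameMap]

@[simp] theorem frameMap_repr_sub (b : OrthonormalBasis (Fin 3) ℝ E3) (o x : E3) :
    frameMap b o (b.repr (x - o)) = x := by
  simp [frameMap_apply]

theorem SectionAxis.frameMap_preimage {K : Set E3} {p n m u : E3} (h : SectionAxis K p n m u)
    (b : OrthonormalBasis (Fin 3) ℝ E3) (o : E3) :
    SectionAxis (frameMap b o ⁻¹' K) (b.repr (p - o)) (b.repr n) (b.repr (m - o)) (b.repr u) where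
  unit := by rw [LinearIsometryEquiv.norm_map, h.unit]
  orth := by rw [LinearIsometryEquiv.inner_map_map, h.orth]
  mem := by
    rw [← map_sub, LinearIsometryEquiv.inner_map_map, sub_sub_sub_cancel_right, h.mem]
  maps y hy hyn := by
    obtain ⟨x, rfl⟩ : ∃ x, y = b.repr (x - o) := ⟨frameMap b o y, by simp [frameMap_apply]⟩
    rw [Set.mem_preimage, frameMap_repr_sub] at hy
    rw [← map_sub, LinearIsometryEquiv.inner_map_map, sub_sub_sub_cancel_right] at hyn
    have := h.maps x hy hyn
    rw [Set.mem_preimage]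
    convert this using 1
    simp only [halfTurn]
    rw [← map_sub, LinearIsometryEquiv.inner_map_map, sub_sub_sub_cancel_right, ← map_smul,
      ← map_add, ← map_smul, ← map_sub, frameMap_apply, LinearIsometryEquiv.symm_apply_apply]
    module

theorem hasCoplanarAxes_frameMap_preimage {K : Set E3} {o p l d : E3} {L : AffineSubspace ℝ E3}
    (hdir : L.direction = Submodule.span ℝ {d}) (hL : ∀ x, x ∈ L ↔ ∃ t : ℝ, x = l + t • d)
    (hsym : ∀ P : AffineSubspace ℝ E3, IsPlane P → p ∈ P →
      ∃ M : AffineSubspace ℝ E3, IsLineOfSymmetry M P K ∧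
        (((M : Set E3) ∩ (L : Set E3)).Nonempty ∨
          (L.direction ≤ P.direction ∧ M.Parallel L)))
    (b : OrthonormalBasis (Fin 3) ℝ E3) (hl2 : b.repr (l - o) 2 = 0) (hd2 : b.repr d 2 = 0) :
    HasCoplanarAxes (frameMap b o ⁻¹' K) (b.repr (p - o)) (b.repr d 1) (-b.repr d 0)
      (b.repr d 1 * b.repr (l - o) 0 - b.repr d 0 * b.repr (l - o) 1) := by
  intro w hw
  obtain ⟨n, rfl⟩ := b.repr.surjective w
  have hn : n ≠ 0 := by simpa using hw
  obtain ⟨M, hM, hML⟩ := hsym _ (isPlane_normal_plane p hn) (AffineSubspace.self_mem_mk' _ _)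
  rcases hML with ⟨m, hmM, hmL⟩ | ⟨-, hpar⟩
  · obtain ⟨u, -, hax⟩ := hM.exists_sectionAxis hmM
    refine ⟨_, _, hax.frameMap_preimage b o, ?_⟩
    obtain ⟨t, rfl⟩ := (hL m).1 hmL
    have e : b.repr (l + t • d - o) = b.repr (l - o) + t • b.repr d := by
      rw [← map_smul, ← map_add]; congr 1; module
    simp only [CoplanarWith, e, PiLp.add_apply, PiLp.smul_apply, smul_eq_mul, hl2, hd2]
    ring
  · obtain ⟨m, hmM⟩ := hM.1.1
    obtain ⟨u, hdu, hax⟩ := hM.exists_sectionAxis hmM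
    refine ⟨_, _, hax.frameMap_preimage b o, ?_⟩
    obtain ⟨c, rfl⟩ : ∃ c : ℝ, c • d = u := by
      rw [← Submodule.mem_span_singleton, ← hdir, ← hpar.direction_eq, hdu]
      exact Submodule.mem_span_singleton_self u
    simp only [CoplanarWith, map_smul, PiLp.smul_apply, smul_eq_mul, hd2]
    ring

theorem exists_orthonormalBasis_of_unit {e n : E3} (he : ‖e‖ = 1) (hn : ‖n‖ = 1)
    (hen : inner ℝ e n = 0) : ∃ b : OrthonormalBasis (Fin 3) ℝ E3, b 0 = e ∧ b 2 = n := by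
  have ho : Orthonormal ℝ ![e, E3.cross e n, n] := by
    constructor
    · intro i
      fin_cases i
      exacts [he, E3.norm_cross he hn hen, hn]
    · have h1 := E3.inner_cross_left e n
      have h2 := E3.inner_cross_right e n
      intro i j hij
      fin_cases i <;> fin_cases j <;> simp_all [real_inner_comm]
  refine ⟨(basisOfOrthonormalOfCardEqFinrank ho (by simp)).toOrthonormalBasis (by simpa using ho),
    ?_, ?_⟩ <;> simp

theorem exists_unit_orthogonal_pair (a d : E3) :
    ∃ n : E3, ‖n‖ = 1 ∧ inner ℝ a n = 0 ∧ inner ℝ d n = 0 := by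
  have h := Submodule.finrank_add_finrank_orthogonal (Submodule.span ℝ {a, d})
  rw [finrank_euclideanSpace_fin] at h
  have h2 : Module.finrank ℝ (Submodule.span ℝ {a, d}) ≤ 2 := by
    classical
    have := finrank_span_finset_le_card (R := ℝ) ({a, d} : Finset E3)
    rw [Finset.coe_pair] at this
    exact this.trans Finset.card_le_two
  have hpos : 0 < Module.finrank ℝ (Submodule.span ℝ {a, d})ᗮ := by omega
  obtain ⟨⟨v, hv⟩, hv0⟩ := Module.finrank_pos_iff_exists_ne_zero.1 hpos
  have hv0' : ‖v‖ ≠ 0 := by simpa using hv0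
  rw [Submodule.mem_orthogonal] at hv
  refine ⟨‖v‖⁻¹ • v, ?_, ?_, ?_⟩
  · rw [norm_smul, norm_inv, norm_norm, inv_mul_cancel₀ hv0']
  · rw [real_inner_smul_right, hv a (Submodule.subset_span (by simp)), mul_zero]
  · rw [real_inner_smul_right, hv d (Submodule.subset_span (by simp)), mul_zero]

theorem eq_smul_of_planar_det_eq_zero {b : OrthonormalBasis (Fin 3) ℝ E3} {x d : E3}
    (hd : ‖d‖ = 1) (hx2 : b.repr x 2 = 0) (hd2 : b.repr d 2 = 0)
    (h : b.repr d 1 * b.repr x 0 - b.repr d 0 * b.repr x 1 = 0) : ∃ t : ℝ, x = t • d := by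
  have hd' : ‖b.repr d‖ = 1 := by rwa [LinearIsometryEquiv.norm_map]
  rw [E3.norm_eq_one_iff, hd2] at hd'
  refine ⟨b.repr x 0 * b.repr d 0 + b.repr x 1 * b.repr d 1, b.repr.injective (E3.ext ?_ ?_ ?_)⟩
  · simp only [map_smul, PiLp.smul_apply, smul_eq_mul]
    linear_combination -b.repr x 0 * hd' + b.repr d 1 * h
  · simp only [map_smul, PiLp.smul_apply, smul_eq_mul]
    linear_combination -b.repr x 1 * hd' - b.repr d 0 * h
  · simp only [map_smul, PiLp.smul_apply, smul_eq_mul, hx2, hd2, mul_zero]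

theorem isBodyOfRevolution_of_mem_of_norm_eq {K : Set E3} {o n : E3} (hn : ‖n‖ = 1)
    (h : ∀ x ∈ K, ∀ y, ‖y - o‖ = ‖x - o‖ → inner ℝ (y - o) n = inner ℝ (x - o) n → y ∈ K) :
    IsBodyOfRevolution K := by
  have hn0 : n ≠ 0 := by rintro rfl; simp at hn
  refine ⟨AffineSubspace.mk' o (ℝ ∙ n), ⟨⟨o, AffineSubspace.self_mem_mk' _ _⟩, ?_⟩, ?_⟩
  · rw [AffineSubspace.direction_mk', finrank_span_singleton hn0]
  have key : ∀ g : E3 ≃ᵃⁱ[ℝ] E3, (∀ x ∈ AffineSubspace.mk' o (ℝ ∙ n), g x = x) →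
      ∀ x ∈ K, g x ∈ K := by
    intro g hg x hx
    have ho : g o = o := hg o (AffineSubspace.self_mem_mk' _ _)
    have hon : g (o + n) = o + n := hg _ (by simp [AffineSubspace.mem_mk'])
    have h1 : ‖g x - o‖ = ‖x - o‖ := by
      have := g.dist_map x o
      rwa [ho, dist_eq_norm, dist_eq_norm] at this
    have h2 : ‖g x - o - n‖ = ‖x - o - n‖ := by
      have := g.dist_map x (o + n)
      rwa [hon, dist_eq_norm, dist_eq_norm, ← sub_sub, ← sub_sub] at this
    refine h x hx _ h1 ?_
    have h3 := norm_sub_sq_real (g x - o) n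
    have h4 := norm_sub_sq_real (x - o) n
    rw [h2, h1] at h3
    linarith
  intro g hg
  refine Set.Subset.antisymm ?_ ?_
  · rintro _ ⟨x, hx, rfl⟩
    exact key g hg x hx
  · intro x hx
    exact ⟨g.symm x, key g.symm (fun y hy => by rw [AffineIsometryEquiv.symm_apply_eq, hg y hy]) x hx,
      by simp⟩

theorem theorem1 (K : ConvexBody E3) (hK : StrictConvex ℝ (K : Set E3))
    (o : E3) (ho : IsCentrallySymmetric (K : Set E3) o)
    (L : AffineSubspace ℝ E3) (hL : IsLine L) (hoL : o ∉ L)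
    (p : E3) (hpΩ : p ∈ affineSpan ℝ (insert o (L : Set E3))) (hpL : p ∉ L)
    (hpK : p ∈ interior (K : Set E3)) (hp : IsLarmanPoint (K : Set E3) p)
    (hperp : p ≠ o → ¬ (line[ℝ, o, p]).direction ⟂ L.direction)
    (hsym : ∀ P : AffineSubspace ℝ E3, IsPlane P → p ∈ P →
      ∃ M : AffineSubspace ℝ E3, IsLineOfSymmetry M P (K : Set E3) ∧
        (((M : Set E3) ∩ (L : Set E3)).Nonempty ∨
          (L.direction ≤ P.direction ∧ M.Parallel L))) :
    (p = o → IsBodyOfRevolution (K : Set E3)) ∧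
      (p ≠ o → ∃ r : ℝ, 0 < r ∧ (K : Set E3) = Metric.closedBall o r) := by
  obtain ⟨l, hl⟩ := hL.1
  obtain ⟨d, hd, hdir, hmem⟩ := hL.exists_unit_direction hl
  obtain ⟨n, hn, hln, hdn⟩ := exists_unit_orthogonal_pair (l - o) d
  have hpn : inner ℝ (p - o) n = 0 := by
    have hle : affineSpan ℝ (insert o (L : Set E3)) ≤ AffineSubspace.mk' o (ℝ ∙ n)ᗮ := by
      rw [affineSpan_le]
      rintro x (rfl | hx)
      · exact AffineSubspace.self_mem_mk' _ _
      · obtain ⟨t, rfl⟩ := (hmem x).1 hx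
        refine mem_normal_plane_iff.2 ?_
        rw [add_sub_right_comm, inner_add_left, hln, real_inner_smul_left, hdn]; ring
    exact mem_normal_plane_iff.1 (hle hpΩ)
  have hneg (b : OrthonormalBasis (Fin 3) ℝ E3) :
      ∀ x ∈ frameMap b o ⁻¹' (K : Set E3), -x ∈ frameMap b o ⁻¹' (K : Set E3) := by
    intro x hx
    have : Equiv.pointReflection o (frameMap b o x) ∈ (K : Set E3) := by
      rw [← ho]; exact ⟨_, hx, rfl⟩
    rw [Set.mem_preimage]
    convert this using 1
    simp [frameMap_apply, Equiv.pointReflection_apply]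
    abel
  have hcpt (b : OrthonormalBasis (Fin 3) ℝ E3) : IsCompact (frameMap b o ⁻¹' (K : Set E3)) :=
    (frameMap b o).toHomeomorph.isCompact_preimage.2 K.isCompact
  have hsc (b : OrthonormalBasis (Fin 3) ℝ E3) : StrictConvex ℝ (frameMap b o ⁻¹' (K : Set E3)) :=
    hK.affine_preimage (f := (frameMap b o).toAffineEquiv.toAffineMap) (frameMap b o).continuous
      (frameMap b o).injective
  have hint (b : OrthonormalBasis (Fin 3) ℝ E3) :
      b.repr (p - o) ∈ interior (frameMap b o ⁻¹' (K : Set E3)) := by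
    have := (frameMap b o).toHomeomorph.preimage_interior (K : Set E3)
    rw [AffineIsometryEquiv.coe_toHomeomorph] at this
    rw [← this, Set.mem_preimage, frameMap_repr_sub]
    exact hpK
  have h2 {b : OrthonormalBasis (Fin 3) ℝ E3} (hb : b 2 = n) {x : E3} (hx : inner ℝ x n = 0) :
      b.repr x 2 = 0 := by rw [b.repr_apply_apply, hb, real_inner_comm, hx]
  have hγ {b : OrthonormalBasis (Fin 3) ℝ E3} (hb : b 2 = n) :
      b.repr d 1 * b.repr (l - o) 0 - b.repr d 0 * b.repr (l - o) 1 ≠ 0 := fun h => by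
    obtain ⟨t, ht⟩ := eq_smul_of_planar_det_eq_zero hd (h2 hb hln) (h2 hb hdn) h
    refine hoL ((hmem o).2 ⟨-t, ?_⟩)
    rw [neg_smul, ← ht]; abel
  refine ⟨?_, fun hpo => ?_⟩
  · rintro rfl
    obtain ⟨b, -, hb⟩ := exists_orthonormalBasis_of_unit hd hn hdn
    have hH := hasCoplanarAxes_frameMap_preimage hdir hmem hsym b (h2 hb hln) (h2 hb hdn)
    have hint' := hint b
    rw [sub_self, map_zero] at hH hint'
    refine isBodyOfRevolution_of_mem_of_norm_eq (o := p) hn fun x hx y hxy hn' => ?_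
    have := hH.mem_of_norm_eq (hcpt b) (hsc b).convex ⟨_, hint'⟩ (interior_subset hint') (hneg b)
      (hγ hb) (x := b.repr (x - p)) (y := b.repr (y - p))
      (by rwa [Set.mem_preimage, frameMap_repr_sub])
      (by rwa [LinearIsometryEquiv.norm_map, LinearIsometryEquiv.norm_map])
      (by rw [b.repr_apply_apply, b.repr_apply_apply, hb, real_inner_comm, hn', real_inner_comm])
    rwa [Set.mem_preimage, frameMap_repr_sub] at this
  · have hpo' : p - o ≠ 0 := sub_ne_zero.2 hpo
    have hpo'' : ‖p - o‖ ≠ 0 := by simpa using hpo'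
    obtain ⟨b, hb0, hb⟩ := exists_orthonormalBasis_of_unit (e := ‖p - o‖⁻¹ • (p - o)) (n := n)
      (by rw [norm_smul, norm_inv, norm_norm, inv_mul_cancel₀ hpo'']) hn
      (by rw [real_inner_smul_left, hpn, mul_zero])
    have hH := hasCoplanarAxes_frameMap_preimage hdir hmem hsym b (h2 hb hln) (h2 hb hdn)
    have hpb : p - o = ‖p - o‖ • b 0 := by rw [hb0, smul_smul, mul_inv_cancel₀ hpo'', one_smul]
    have hp1 : b.repr (p - o) 1 = 0 := by rw [hpb]; simp
    have hp0 : b.repr (p - o) 0 ≠ 0 := by rw [hpb]; simpa using hpo'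
    have hd0 : -b.repr d 0 ≠ 0 := by
      rw [neg_ne_zero]
      intro h
      apply hperp hpo
      rw [direction_affineSpan, vectorSpan_pair_rev, hdir, Submodule.isOrtho_span]
      rintro _ rfl _ rfl
      rw [vsub_eq_sub, hpb, real_inner_smul_left, ← b.repr_apply_apply, h, mul_zero]
    obtain ⟨r, hr, hball⟩ := hH.eq_closedBall (hcpt b) (hsc b) (hneg b) (hint b) hp0 hp1
      (h2 hb hpn) hd0 (hγ hb) (fun h => by
        obtain ⟨t, ht⟩ := eq_smul_of_planar_det_eq_zero (b := b) (x := l - p) hd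
          (by rw [← sub_sub_sub_cancel_right l p o, map_sub, PiLp.sub_apply, h2 hb hln, h2 hb hpn,
            sub_zero]) (h2 hb hdn) (by
            rw [← sub_sub_sub_cancel_right l p o, map_sub, PiLp.sub_apply, PiLp.sub_apply, hp1]
            linear_combination -h)
        refine hpL ((hmem p).2 ⟨-t, ?_⟩)
        rw [neg_smul, ← ht]; abel)
    refine ⟨r, hr, ?_⟩
    ext x
    have : b.repr (x - o) ∈ frameMap b o ⁻¹' (K : Set E3) ↔
        b.repr (x - o) ∈ Metric.closedBall 0 r := by rw [hball]
    rw [Set.mem_preimage, frameMap_repr_sub, mem_closedBall_zero_iff,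
      LinearIsometryEquiv.norm_map] at this
    rw [this, mem_closedBall_iff_norm]
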